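/- Let $\mathcal P=\{(a,b)\in\mathbb R^2 : a\le 0\le b,\ b-a\ge 1,\ -ab\le 1\}$, and on $\bar{\mathbb R}=\mathbb R\cup\{\infty\}$ let $T x=x+1$, $S x=-1/x$. For $(a,b)\in\mathcal P$ let $f=f_{a,b}$ be given by $f(x)=Tx$ for $x<a$, $f(x)=Sx$ for $a\le x<b$, $f(x)=T^{-1}x$ for $x\ge b$ (and $f(\infty)=\infty$). Each of the points $a,b$ has an upper and a lower orbit under $f$: the upper orbit of $a$ starts at $Sa$ and the lower one at $Ta$; the upper orbit of $b$ starts at $T^{-1}b$ and the lower one at $Sb$; whenever an upper (respectively lower) orbit hits $a$ or $b$, the next point is $Sa$ or $T^{-1}b$ (respectively $Ta$ or $Sb$). The point $a$ (or $b$) has the cycle property if its upper and lower orbits have a common point; the cycle ends at the first common point along the lower orbit, and the upper and lower sides of the cycle consist of the points of the two orbits before their first visits to the end. The cycle is strong if the composition of the transformations $T^{\pm1},S$ from the point along the upper side to the end equals that along the lower side, and weak otherwise. The upper (lower) truncated orbit is the whole upper (lower) orbit if there is no cycle, the upper (lower) side of the cycle if the cycle is strong, and that side together with $0$ if it is weak.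 The map $f_{a,b}$ satisfies the finiteness condition if the four truncated orbits (upper and lower, of $a$ and of $b$) are finite sets. Let $\mathcal E$ be the set of $(a,b)\in\mathcal P$ for which it does not. For an integer $m\ge 3$ put $A^{(0)}=(m)$, $B^{(0)}=(m+1)$, and for $n\ge0$ choose one of $$A^{(n+1)}=(\underbrace{A^{(n)},\dots,A^{(n)}}_{l},B^{(n)}),\quad B^{(n+1)}=(\underbrace{A^{(n)},\dots,A^{(n)}}_{l-1},B^{(n)})\qquad(l\ge 2),$$ $$A^{(n+1)}=(A^{(n)},\underbrace{B^{(n)},\dots,B^{(n)}}_{l}),\quad B^{(n+1)}=(A^{(n)},\underbrace{B^{(n)},\dots,B^{(n)}}_{l+1})\qquad(l\ge 1),$$ with the case and the integer $l$ depending on $n$. Each $A^{(n)}$ is an initial block of $A^{(n+1)}$; let $(n_i)_{i\ge1}$ be the infinite sequence that starts with every $A^{(n)}$. Write $(0,n_1,n_2,\dots)$ for the limit of the finite continued fractions $(0,n_1,\dots,n_k)=0-\cfrac1{n_1-\cfrac1{\ddots-\cfrac1{n_k}}}$. **Theorem.** For every $(a,b)\in\mathcal P$ with $b\ne a+1$ the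 finiteness condition holds. The exceptional set $\mathcal E$ is an uncountable subset of the segment $b=a+1$ of the boundary of $\mathcal P$ and has one-dimensional Lebesgue measure zero. It is invariant under $(a,b)\mapsto(-b,-a)$, and its part with $b\le -a$ is exactly the set of points $(b-1,b)$ with $b=-(0,n_1,n_2,\dots)$, where $m\ge3$ and $(n_i)$ is a sequence constructed as above; moreover for every $m\ge 3$ and all choices the sequence $(n_i)$ is not eventually periodic, the limit exists, and the point $(b-1,b)$ belongs to $\mathcal E$. -/

import Mathlib

open Filter Topology MeasureTheory

namespace ABCF

noncomputable section

/-! ### The parameter set and the maps -/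

/-- The parameter set `𝒫 = {(a,b) : a ≤ 0 ≤ b, b - a ≥ 1, -ab ≤ 1}`. -/
def paramSet : Set (ℝ × ℝ) :=
  {p | p.1 ≤ 0 ∧ 0 ≤ p.2 ∧ 1 ≤ p.2 - p.1 ∧ -(p.1 * p.2) ≤ 1}

/-- `x ↦ x + c` on the extended real line `ℝ ∪ {∞}`, fixing `∞`. -/
def shift (c : ℝ) : OnePoint ℝ → OnePoint ℝ
  | OnePoint.infty => OnePoint.infty
  | OnePoint.some x => ((x + c : ℝ) : OnePoint ℝ)

/-- `x ↦ -1/x` on the extended real line, exchanging `0` and `∞`. -/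
def negInv : OnePoint ℝ → OnePoint ℝ
  | OnePoint.infty => ((0 : ℝ) : OnePoint ℝ)
  | OnePoint.some x => if x = 0 then OnePoint.infty else ((-1 / x : ℝ) : OnePoint ℝ)

theorem shift_shift_neg (c : ℝ) (x : OnePoint ℝ) : shift (-c) (shift c x) = x := by
  induction x using OnePoint.rec with
  | infty => rfl
  | coe x => simp [shift]

theorem negInv_negInv (x : OnePoint ℝ) : negInv (negInv x) = x := by
  induction x using OnePoint.rec with
  | infty => simp [negInv]
  | coe x =>
    by_cases h : x = 0
    · simp [negInv, h]
    · simp [negInv, h, neg_div]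

/-- The transformation `T x = x + 1`. -/
def T : Equiv.Perm (OnePoint ℝ) where
  toFun := shift 1
  invFun := shift (-1)
  left_inv := shift_shift_neg 1
  right_inv x := by simpa using shift_shift_neg (-1) x

/-- The transformation `S x = -1/x`. -/
def S : Equiv.Perm (OnePoint ℝ) where
  toFun := negInv
  invFun := negInv
  left_inv := negInv_negInv
  right_inv := negInv_negInv

/-- The map `ρ` with `f_{a,b}(x) = ρ(x) x`: it is `T` for `x < a`, `S` for `a ≤ x < b` and `T⁻¹` for
`x ≥ b`.  It governs the upper orbits: at the points `a` and `b` it follows the rules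
`a ↦ S a`, `b ↦ T⁻¹ b`.  (At the common fixed point `∞` of `T` and `T⁻¹` we take `T⁻¹`.) -/
def rhoUpper (a b : ℝ) : OnePoint ℝ → Equiv.Perm (OnePoint ℝ)
  | OnePoint.infty => T⁻¹
  | OnePoint.some x => if x < a then T else if x < b then S else T⁻¹

/-- The same map with the lower convention at the discontinuity points: `a ↦ T a`, `b ↦ S b`.
It agrees with `rhoUpper` except at `a` and `b`. -/
def rhoLower (a b : ℝ) : OnePoint ℝ → Equiv.Perm (OnePoint ℝ)
  | OnePoint.infty => T⁻¹
  | OnePoint.some x => if x ≤ a then T else if x ≤ b then S else T⁻¹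

/-- The map `f_{a,b}` on the extended real line. -/
def f (a b : ℝ) (x : OnePoint ℝ) : OnePoint ℝ := rhoUpper a b x x

/-! ### Orbits, cycles and truncated orbits -/

/-- The `n`-th point of the orbit of `x` under `y ↦ ρ(y) y`. -/
def orbit (ρ : OnePoint ℝ → Equiv.Perm (OnePoint ℝ)) (x : OnePoint ℝ) : ℕ → OnePoint ℝ
  | 0 => x
  | n + 1 => ρ (orbit ρ x n) (orbit ρ x n)

/-- The product `ρ(x_{n-1}) ⋯ ρ(x_1) ρ(x_0)` of the transformations applied in the first `n` steps of
the orbit `x_0, x_1, …` of `x`. -/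
def word (ρ : OnePoint ℝ → Equiv.Perm (OnePoint ℝ)) (x : OnePoint ℝ) :
    ℕ → Equiv.Perm (OnePoint ℝ)
  | 0 => 1
  | n + 1 => ρ (orbit ρ x n) * word ρ x n

/-- A discontinuity point `c` of `f_{a,b}`, with the first moves `gu`, `gl` of its upper and its
lower orbit: the upper orbit is that of `gu c`, the lower one that of `gl c`. -/
structure SplitPoint where
  a : ℝ
  b : ℝ
  c : ℝ
  gu : Equiv.Perm (OnePoint ℝ)
  gl : Equiv.Perm (OnePoint ℝ)

/-- The point `a`: its upper orbit starts at `S a`, its lower orbit at `T a`. -/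
def splitA (a b : ℝ) : SplitPoint := ⟨a, b, a, S, T⟩

/-- The point `b`: its upper orbit starts at `T⁻¹ b`, its lower orbit at `S b`. -/
def splitB (a b : ℝ) : SplitPoint := ⟨a, b, b, T⁻¹, S⟩

namespace SplitPoint

variable (s : SplitPoint)

/-- The upper orbit. -/
def up (n : ℕ) : OnePoint ℝ := orbit (rhoUpper s.a s.b) (s.gu (s.c : OnePoint ℝ)) n

/-- The lower orbit. -/
def lo (n : ℕ) : OnePoint ℝ := orbit (rhoLower s.a s.b) (s.gl (s.c : OnePoint ℝ)) n

/-- The cycle property: the upper and the lower orbit meet. -/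
def HasCycle : Prop := ∃ m k : ℕ, s.up m = s.lo k

/-- The length of the lower side of the cycle: the first time the lower orbit meets the upper one.
(Meaningful if the cycle property holds.) -/
def loLength : ℕ := sInf {k | ∃ m, s.up m = s.lo k}

/-- The length of the upper side of the cycle: the first time at which the upper orbit is at the
end of the cycle. -/
def upLength : ℕ := sInf {m | s.up m = s.lo s.loLength}

/-- The cycle property is strong if the product over the cycle is the identity transformation. -/
def HasStrongCycle : Prop :=
  s.HasCycle ∧
    s.gl⁻¹ * (word (rhoLower s.a s.b) (s.gl (s.c : OnePoint ℝ)) s.loLength)⁻¹ *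
      word (rhoUpper s.a s.b) (s.gu (s.c : OnePoint ℝ)) s.upLength * s.gu = 1

/-- The lower side of the cycle, without the end of the cycle. -/
def loSide : Set (OnePoint ℝ) := {y | ∃ k < s.loLength, y = s.lo k}

/-- The upper side of the cycle, without the end of the cycle. -/
def upSide : Set (OnePoint ℝ) := {y | ∃ m < s.upLength, y = s.up m}

open Classical in
/-- The lower truncated orbit: the whole lower orbit if there is no cycle, the lower side of the
cycle if the cycle is strong, and the lower side together with `0` if the cycle is weak. -/
def truncLo : Set (OnePoint ℝ) :=
  if s.HasCycle then
    if s.HasStrongCycle then s.loSide else s.loSide ∪ {((0 : ℝ) : OnePoint ℝ)}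
  else Set.range s.lo

open Classical in
/-- The upper truncated orbit. -/
def truncUp : Set (OnePoint ℝ) :=
  if s.HasCycle then
    if s.HasStrongCycle then s.upSide else s.upSide ∪ {((0 : ℝ) : OnePoint ℝ)}
  else Set.range s.up

end SplitPoint

/-- The finiteness condition for `f_{a,b}`: all four truncated orbits are finite. -/
def FinitenessCondition (a b : ℝ) : Prop :=
  (splitA a b).truncLo.Finite ∧ (splitB a b).truncLo.Finite ∧
    (splitA a b).truncUp.Finite ∧ (splitB a b).truncUp.Finite

/-- The set of exceptions to the finiteness condition. -/
def exceptionalSet : Set (ℝ × ℝ) :=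
  {p | p ∈ paramSet ∧ ¬ FinitenessCondition p.1 p.2}

/-! ### Block substitutions and formal continued fractions -/

/-- One choice of a block substitution: `caseA l` (with `l ≥ 2`) is
`A ↦ A^l B, B ↦ A^(l-1) B`, and `caseB l` (with `l ≥ 1`) is `A ↦ A B^l, B ↦ A B^(l+1)`. -/
inductive Rule where
  | caseA (l : ℕ) (hl : 2 ≤ l) : Rule
  | caseB (l : ℕ) (hl : 1 ≤ l) : Rule

/-- The word `w` repeated `l` times. -/
def repeated (l : ℕ) (w : List ℕ) : List ℕ := (List.replicate l w).flatten

/-- Application of a block substitution to a pair of blocks `(A, B)`. -/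
def Rule.apply : Rule → List ℕ × List ℕ → List ℕ × List ℕ
  | caseA l _, (A, B) => (repeated l A ++ B, repeated (l - 1) A ++ B)
  | caseB l _, (A, B) => (A ++ repeated l B, A ++ repeated (l + 1) B)

/-- The blocks `(A^(n), B^(n))` that start with `A^(0) = m`, `B^(0) = m + 1`. -/
def blocks (m : ℕ) (r : ℕ → Rule) : ℕ → List ℕ × List ℕ
  | 0 => ([m], [m + 1])
  | n + 1 => (r n).apply (blocks m r n)

/-- The sequence `σ` (whose entries `σ 0, σ 1, …` are the digits `n_1, n_2, …`) is constructed by the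
block substitutions `r`: it starts with the block `A^(n)` for every `n`. As the lengths of these
blocks tend to infinity, `σ` is determined by `m` and `r`. -/
def IsGenerated (m : ℕ) (r : ℕ → Rule) (σ : ℕ → ℕ) : Prop :=
  ∀ n, (List.range (blocks m r n).1.length).map σ = (blocks m r n).1

/-- `σ` is eventually periodic. -/
def EventuallyPeriodic (σ : ℕ → ℕ) : Prop := ∃ N p : ℕ, 0 < p ∧ ∀ i, N ≤ i → σ (i + p) = σ i

/-- The formal minus continued fraction `(α_0, α_1, …, α_k) = α_0 - 1/(α_1 - 1/(⋯ - 1/α_k))`. -/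
def minusFrac : List ℝ → ℝ
  | [] => 0
  | [x] => x
  | x :: y :: l => x - 1 / minusFrac (y :: l)

/-- `b = -(0, n_1, n_2, …)` with `n_(i+1) = σ i`, as the limit of the finite continued fractions. -/
def IsMinusFracValue (σ : ℕ → ℕ) (b : ℝ) : Prop :=
  Tendsto (fun k : ℕ => -minusFrac (0 :: (List.range k).map (fun i => (σ i : ℝ)))) atTop (𝓝 b)

/-- The points `(b - 1, b)` with `b = -(0, n_1, n_2, …)`, where `(n_i)` is a sequence constructed by
block substitutions from the digits `m, m + 1`, for some `m ≥ 3`. -/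
def blockPoints : Set (ℝ × ℝ) :=
  {p | ∃ m : ℕ, 3 ≤ m ∧ ∃ (r : ℕ → Rule) (σ : ℕ → ℕ) (b : ℝ),
    IsGenerated m r σ ∧ IsMinusFracValue σ b ∧ p = (b - 1, b)}

end

end ABCF

/-!
The upper and the lower orbit of a discontinuity point move in parallel. Suppose `b ≤ -a`; the
reflection `x ↦ -x` exchanges upper and lower orbits and gives the other half of the parameter set.
The relations between `S` and `T` show that, until the two orbits meet, the lower orbit returns to
points `x 0, x 1, …` with `1 / x i = n i - x (i + 1)`, where the `n i` are integers, and the upper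
orbit is determined by the same numbers (`SplitPoint.descent`, `SplitPoint.Return.exists_next`).
Here `x 0 = a + 1` for the orbits of `a` and `x 0 = b` for those of `b`. The orbits never meet only
if `x i ≤ a + 1` and `1 / x i ≤ 1 / b + 1` for all `i ≥ 1`. As a cycle has finite sides, the
finiteness condition can fail only if this holds and the `x i` take infinitely many values. In the
region `a ≤ -1` the finiteness condition always holds, by direct inspection of the orbits.

In terms of the digits `n i`, where larger digits belong to smaller numbers, these bounds imply
that `n i = m + σ i` with `m = n 0` and a sequence `σ = 0w` of letters `0`, `1` with `0w ≤ σ' ≤ 1w`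
for all tails `σ'` of `σ` (`Adm`, `IsExpansion.exists_gen`). These inequalities determine the
lengths of the runs of equal letters up to one unit, so that such a sequence is the image of
another sequence under one of the block substitutions (`Adm.exists_eq_subst`), and the inequalities
and the aperiodicity are inherited by the preimage (`Adm.of_subst`, `EventuallyPeriodic.subst`).
Iteration shows that `σ` is generated by block substitutions (`Adm.gen`). Conversely, block
substitutions are strictly monotone, so that generated sequences satisfy the inequalities
(`Gen.adm`).

For a generated sequence, both bounds `0w` and `1w` are limits of tails (`Gen.exists_agree_self`,
`Gen.exists_agree_top`). This has two consequences. The sequence is not eventually periodic, since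
otherwise `0w` and `1w` would lie on a single cycle of the shift (`Gen.not_eventuallyPeriodic`).
And the bounds for the `x i` are sharp, which is impossible if `a + 1 < b`: exceptional points
satisfy `b = a + 1` (`not_tame_splitA`, `not_tame_splitB`). Conversely, for the value `b` of a
generated continued fraction and `a = b - 1`, the two orbits of `b` stay in disjoint sets and the
lower one is infinite (`not_tame_of_gen`).

The exceptional set is uncountable because different choices of substitutions give different
sequences. It has measure zero because the values of continued fractions with digits `m`, `m + 1`
are covered by their images under two maps that contract by the factor `1/4`.
-/

namespace ABCF

/-! ### Block substitutions on sequences -/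

theorem repeated_singleton (l d : ℕ) : repeated l [d] = List.replicate l d := by
  simp [repeated, List.flatten_replicate_singleton]

/-- The image of the letter `d` (with `d = 0` for `A`, `d ≠ 0` for `B`) under a block substitution,
as a word in the letters `0`, `1`. -/
def Rule.block (ρ : Rule) (d : ℕ) : List ℕ :=
  if d = 0 then (ρ.apply ([0], [1])).1 else (ρ.apply ([0], [1])).2

theorem Rule.block_caseA_zero (l : ℕ) (hl : 2 ≤ l) :
    (Rule.caseA l hl).block 0 = List.replicate l 0 ++ [1] := by
  simp [Rule.block, Rule.apply, repeated_singleton]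

theorem Rule.block_caseA_one (l : ℕ) (hl : 2 ≤ l) {d : ℕ} (hd : d ≠ 0) :
    (Rule.caseA l hl).block d = List.replicate (l - 1) 0 ++ [1] := by
  simp [Rule.block, Rule.apply, repeated_singleton, hd]

theorem Rule.block_caseB_zero (l : ℕ) (hl : 1 ≤ l) :
    (Rule.caseB l hl).block 0 = 0 :: List.replicate l 1 := by
  simp [Rule.block, Rule.apply, repeated_singleton]

theorem Rule.block_caseB_one (l : ℕ) (hl : 1 ≤ l) {d : ℕ} (hd : d ≠ 0) :
    (Rule.caseB l hl).block d = 0 :: List.replicate (l + 1) 1 := by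
  simp [Rule.block, Rule.apply, repeated_singleton, hd]

theorem Rule.exists_block_eq (ρ : Rule) (d : ℕ) : ∃ e w, ρ.block d = 0 :: e :: w := by
  rcases ρ with ⟨l, hl⟩ | ⟨l, hl⟩ <;> by_cases hd : d = 0
  · obtain ⟨l, rfl⟩ := Nat.exists_eq_add_of_le' hl
    simp [hd, Rule.block_caseA_zero, List.replicate_succ]
  · obtain ⟨l, rfl⟩ := Nat.exists_eq_add_of_le' hl
    simp [Rule.block_caseA_one _ _ hd, List.replicate_succ]
    cases l <;> simp [List.replicate_succ]
  · obtain ⟨l, rfl⟩ := Nat.exists_eq_add_of_le' hl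
    simp [hd, Rule.block_caseB_zero, List.replicate_succ]
  · simp [Rule.block_caseB_one _ _ hd, List.replicate_succ]

theorem Rule.two_le_length_block (ρ : Rule) (d : ℕ) : 2 ≤ (ρ.block d).length := by
  obtain ⟨e, w, h⟩ := ρ.exists_block_eq d
  simp [h]

theorem Rule.block_le_one (ρ : Rule) (d : ℕ) : ∀ e ∈ ρ.block d, e ≤ 1 := by
  intro e he
  rcases ρ with ⟨l, hl⟩ | ⟨l, hl⟩ <;> by_cases hd : d = 0
  · simp [hd, Rule.block_caseA_zero] at he; omega
  · simp [Rule.block_caseA_one _ _ hd] at he; omega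
  · simp [hd, Rule.block_caseB_zero] at he; omega
  · rw [Rule.block_caseB_one _ _ hd] at he; simp at he; omega

/-- The entry of index `i` in the image of the sequence `x` under a block substitution. -/
def substGet (ρ : Rule) (x : Stream' ℕ) (i : ℕ) : ℕ :=
  if h : i < (ρ.block (x.get 0)).length then (ρ.block (x.get 0))[i]
  else substGet ρ x.tail (i - (ρ.block (x.get 0)).length)
termination_by i
decreasing_by
  have := ρ.two_le_length_block (x.get 0)
  omega

/-- The image of the sequence `x` under a block substitution: the concatenation of the blocks
`ρ.block (x 0)`, `ρ.block (x 1)`, …. -/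
def subst (ρ : Rule) (x : Stream' ℕ) : Stream' ℕ := substGet ρ x

theorem subst_eq (ρ : Rule) (x : Stream' ℕ) :
    subst ρ x = ρ.block (x.get 0) ++ₛ subst ρ x.tail := by
  ext i
  change substGet ρ x i = _
  rw [substGet]
  split_ifs with h
  · rw [Stream'.get_append_left _ _ _ h]
  · obtain ⟨j, rfl⟩ := Nat.exists_eq_add_of_le (not_lt.1 h)
    rw [Stream'.get_append_right]
    simp [subst, Stream'.get]

theorem subst_cons (ρ : Rule) (d : ℕ) (x : Stream' ℕ) :
    subst ρ (Stream'.cons d x) = ρ.block d ++ₛ subst ρ x :=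
  subst_eq ρ (Stream'.cons d x)

theorem exists_subst_eq_cons (ρ : Rule) (x : Stream' ℕ) :
    ∃ u, subst ρ x = Stream'.cons 0 u := by
  obtain ⟨e, w, h⟩ := ρ.exists_block_eq (x.get 0)
  exact ⟨(e :: w) ++ₛ subst ρ x.tail, by rw [subst_eq, h]; rfl⟩

/-- Every tail of the image of `x` is a nonempty final part `v` of a block, followed by the images
of the remaining letters. -/
theorem drop_subst (ρ : Rule) (x : Stream' ℕ) (k : ℕ) :
    ∃ j u v, v ≠ [] ∧ ρ.block (x.get j) = u ++ v ∧
      (subst ρ x).drop k = v ++ₛ subst ρ (x.drop (j + 1)) := by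
  induction k using Nat.strong_induction_on generalizing x with
  | _ k ih =>
    have h2 := ρ.two_le_length_block (x.get 0)
    by_cases hk : k < (ρ.block (x.get 0)).length
    · refine ⟨0, (ρ.block (x.get 0)).take k, (ρ.block (x.get 0)).drop k, ?_, by simp, ?_⟩
      · simpa using hk
      · rw [subst_eq, Stream'.drop_append_of_le_length _ _ _ hk.le]
        rfl
    · obtain ⟨i, rfl⟩ := Nat.exists_eq_add_of_le (not_lt.1 hk)
      obtain ⟨j, u, v, hv, huv, h⟩ := ih i (by omega) x.tail
      refine ⟨j + 1, u, v, hv, huv, ?_⟩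
      rw [subst_eq, ← Stream'.drop_drop, Stream'.drop_append_stream, h]
      rfl

/-- The image of a tail is a tail of the image. -/
theorem exists_drop_subst (ρ : Rule) (x : Stream' ℕ) (j : ℕ) :
    ∃ k, j ≤ k ∧ (subst ρ x).drop k = subst ρ (x.drop j) := by
  induction j generalizing x with
  | zero => exact ⟨0, le_rfl, rfl⟩
  | succ j ih =>
    obtain ⟨k, hk, h⟩ := ih x.tail
    have h2 := ρ.two_le_length_block (x.get 0)
    refine ⟨(ρ.block (x.get 0)).length + k, by omega, ?_⟩
    rw [subst_eq, ← Stream'.drop_drop, Stream'.drop_append_stream, h]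
    rfl

/-- The block substitutions of the first kind end every block with the letter `1`. -/
theorem exists_drop_subst_caseA (l : ℕ) (hl : 2 ≤ l) (x : Stream' ℕ) (j : ℕ) :
    ∃ k, (subst (Rule.caseA l hl) x).drop k =
      Stream'.cons 1 (subst (Rule.caseA l hl) (x.drop (j + 1))) := by
  obtain ⟨k, -, h⟩ := exists_drop_subst (Rule.caseA l hl) x j
  have key : ∃ n, (Rule.caseA l hl).block ((x.drop j).get 0) = List.replicate n 0 ++ [1] := by
    by_cases hd : (x.drop j).get 0 = 0
    · exact ⟨l, by rw [hd, Rule.block_caseA_zero]⟩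
    · exact ⟨l - 1, by rw [Rule.block_caseA_one _ _ hd]⟩
  obtain ⟨n, hn⟩ := key
  refine ⟨k + n, ?_⟩
  have h3 := Stream'.drop_append_stream (List.replicate n 0)
    ([1] ++ₛ subst (Rule.caseA l hl) (x.drop (j + 1)))
  rw [← Stream'.drop_drop, h, subst_eq, hn, Stream'.append_append_stream, Stream'.tail_drop']
  simpa using h3

/-! ### Lexicographic comparison of sequences -/

/-- `x` is lexicographically at most `y`, as far as the first `N` entries can tell. -/
def LexLE : ℕ → Stream' ℕ → Stream' ℕ → Prop
  | 0, _, _ => True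
  | N + 1, x, y => x.get 0 < y.get 0 ∨ (x.get 0 = y.get 0 ∧ LexLE N x.tail y.tail)

theorem lexLE_cons {N a b : ℕ} {x y : Stream' ℕ} :
    LexLE (N + 1) (Stream'.cons a x) (Stream'.cons b y) ↔ a < b ∨ (a = b ∧ LexLE N x y) :=
  Iff.rfl

theorem lexLE_cons_self {N a : ℕ} {x y : Stream' ℕ} :
    LexLE (N + 1) (Stream'.cons a x) (Stream'.cons a y) ↔ LexLE N x y := by
  simp [lexLE_cons]

theorem LexLE.refl (N : ℕ) (x : Stream' ℕ) : LexLE N x x := by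
  induction N generalizing x with
  | zero => trivial
  | succ N ih => exact Or.inr ⟨rfl, ih _⟩

theorem LexLE.of_le {M N : ℕ} (h : M ≤ N) {x y : Stream' ℕ} (hxy : LexLE N x y) : LexLE M x y := by
  induction M generalizing N x y with
  | zero => trivial
  | succ M ih =>
    obtain ⟨N, rfl⟩ : ∃ K, N = K + 1 := ⟨N - 1, by omega⟩
    rcases hxy with h1 | ⟨h1, h2⟩
    · exact Or.inl h1
    · exact Or.inr ⟨h1, ih (by omega) h2⟩

theorem LexLE.get_eq {N : ℕ} {x y : Stream' ℕ} (h : LexLE N x y) (h' : LexLE N y x) :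
    ∀ i < N, x.get i = y.get i := by
  induction N generalizing x y with
  | zero => simp
  | succ N ih =>
    rcases h with h1 | ⟨h1, h2⟩ <;> rcases h' with h3 | ⟨h3, h4⟩ <;> try omega
    intro i hi
    cases i with
    | zero => exact h1
    | succ i => exact ih h2 h4 i (by omega)

theorem LexLE.antisymm {x y : Stream' ℕ} (h : ∀ N, LexLE N x y) (h' : ∀ N, LexLE N y x) : x = y :=
  Stream'.ext fun i => (h (i + 1)).get_eq (h' (i + 1)) i (Nat.lt_succ_self i)

theorem lexLE_append {N : ℕ} (w : List ℕ) {x y : Stream' ℕ} :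
    LexLE (w.length + N) (w ++ₛ x) (w ++ₛ y) ↔ LexLE N x y := by
  induction w with
  | nil => simp
  | cons a w ih =>
    rw [← ih, List.length_cons, show w.length + 1 + N = (w.length + N) + 1 by omega,
      Stream'.cons_append_stream, Stream'.cons_append_stream, lexLE_cons_self]

theorem lexLE_append_of_lt (N : ℕ) (w : List ℕ) {a b : ℕ} (h : a < b) (x y : Stream' ℕ) :
    LexLE N (w ++ₛ Stream'.cons a x) (w ++ₛ Stream'.cons b y) := by
  refine LexLE.of_le (Nat.le_add_left N w.length) ((lexLE_append w).2 ?_)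
  cases N with
  | zero => trivial
  | succ N => exact Or.inl h

theorem not_lexLE_append_of_lt (w : List ℕ) {a b : ℕ} (h : a < b) (x y : Stream' ℕ) :
    ¬ LexLE (w.length + 1) (w ++ₛ Stream'.cons b x) (w ++ₛ Stream'.cons a y) := by
  rw [lexLE_append, lexLE_cons]
  omega

theorem lexLE_cons_of_lt (N : ℕ) {a b : ℕ} (h : a < b) (x y : Stream' ℕ) :
    LexLE N (Stream'.cons a x) (Stream'.cons b y) :=
  lexLE_append_of_lt N [] h x y

/-- The images of `0` and `1` diverge, and they do so in the order of the letters. -/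
theorem Rule.exists_block_append (ρ : Rule) : ∃ w : List ℕ, ∀ x y : Stream' ℕ, ∃ u v : Stream' ℕ,
    ρ.block 0 ++ₛ subst ρ x = w ++ₛ Stream'.cons 0 u ∧
    ρ.block 1 ++ₛ subst ρ y = w ++ₛ Stream'.cons 1 v := by
  rcases ρ with ⟨l, hl⟩ | ⟨l, hl⟩
  · refine ⟨List.replicate (l - 1) 0, fun x y => ⟨[1] ++ₛ subst (Rule.caseA l hl) x,
      subst (Rule.caseA l hl) y, ?_, ?_⟩⟩
    · obtain ⟨l, rfl⟩ : ∃ k, l = k + 1 := ⟨l - 1, by omega⟩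
      rw [Rule.block_caseA_zero, List.replicate_succ', List.append_assoc,
        Stream'.append_append_stream]
      rfl
    · rw [Rule.block_caseA_one _ _ one_ne_zero, Stream'.append_append_stream]
      rfl
  · refine ⟨0 :: List.replicate l 1, fun x y => ?_⟩
    obtain ⟨u, hu⟩ := exists_subst_eq_cons (Rule.caseB l hl) x
    refine ⟨u, subst (Rule.caseB l hl) y, by rw [Rule.block_caseB_zero, hu], ?_⟩
    rw [Rule.block_caseB_one _ _ one_ne_zero, List.replicate_succ', ← List.cons_append,
      Stream'.append_append_stream]
    rfl

/-- Only the letters `0` and `1` occur in `x`. -/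
def Binary (x : Stream' ℕ) : Prop := ∀ i, x.get i ≤ 1

theorem Binary.tail {x : Stream' ℕ} (h : Binary x) : Binary x.tail := fun i => h (i + 1)

theorem Binary.drop {x : Stream' ℕ} (h : Binary x) (k : ℕ) : Binary (x.drop k) := fun i => h (i + k)

theorem binary_subst (ρ : Rule) (x : Stream' ℕ) : Binary (subst ρ x) := by
  intro k
  obtain ⟨j, u, v, hv, huv, h⟩ := drop_subst ρ x k
  obtain ⟨a, v, rfl⟩ := List.exists_cons_of_ne_nil hv
  have h1 : (subst ρ x).get k = a := by
    have := congrArg (fun s => Stream'.get s 0) h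
    simpa [Stream'.get_drop, Stream'.cons_append_stream] using this
  rw [h1]
  exact ρ.block_le_one (x.get j) a (by simp [huv])

/-- Block substitutions are monotone; an agreement of length `N` becomes one of length `2N + 1`. -/
theorem LexLE.subst {N : ℕ} {x y : Stream' ℕ} (hx : Binary x) (hy : Binary y) (h : LexLE N x y)
    (ρ : Rule) : LexLE (2 * N + 1) (subst ρ x) (subst ρ y) := by
  induction N generalizing x y with
  | zero =>
    obtain ⟨u, hu⟩ := exists_subst_eq_cons ρ x
    obtain ⟨v, hv⟩ := exists_subst_eq_cons ρ y
    rw [hu, hv, lexLE_cons_self]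
    trivial
  | succ N ih =>
    rw [subst_eq ρ x, subst_eq ρ y]
    rcases h with h1 | ⟨h1, h2⟩
    · have h3 : x.get 0 = 0 := by have := hy 0; omega
      have h4 : y.get 0 = 1 := by have := hy 0; omega
      obtain ⟨w, hw⟩ := ρ.exists_block_append
      obtain ⟨u, v, hu, hv⟩ := hw x.tail y.tail
      rw [h3, h4, hu, hv]
      exact lexLE_append_of_lt _ _ Nat.zero_lt_one _ _
    · rw [h1]
      have := (lexLE_append (ρ.block (y.get 0))).2 (ih hx.tail hy.tail h2)
      have h5 := ρ.two_le_length_block (y.get 0)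
      exact this.of_le (by omega)

/-- Block substitutions also reflect the lexicographic order. -/
theorem LexLE.of_subst {x y : Stream' ℕ} (hx : Binary x) (hy : Binary y) (ρ : Rule)
    (h : ∀ M, LexLE M (ABCF.subst ρ x) (ABCF.subst ρ y)) (N : ℕ) : LexLE N x y := by
  induction N generalizing x y with
  | zero => trivial
  | succ N ih =>
    rcases lt_trichotomy (x.get 0) (y.get 0) with h1 | h1 | h1
    · exact Or.inl h1
    · refine Or.inr ⟨h1, ih hx.tail hy.tail fun M => ?_⟩
      have := h ((ρ.block (y.get 0)).length + M)
      rwa [subst_eq ρ x, subst_eq ρ y, h1, lexLE_append] at this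
    · have h3 : y.get 0 = 0 := by have := hx 0; omega
      have h4 : x.get 0 = 1 := by have := hx 0; omega
      obtain ⟨w, hw⟩ := ρ.exists_block_append
      obtain ⟨u, v, hu, hv⟩ := hw y.tail x.tail
      have := h (w.length + 1)
      rw [subst_eq ρ x, subst_eq ρ y, h3, h4, hu, hv] at this
      exact absurd this (not_lexLE_append_of_lt _ Nat.zero_lt_one _ _)

theorem subst_injective {x y : Stream' ℕ} (hx : Binary x) (hy : Binary y) (ρ : Rule)
    (h : subst ρ x = subst ρ y) : x = y :=
  LexLE.antisymm (LexLE.of_subst hx hy ρ fun M => h ▸ LexLE.refl M _)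
    (LexLE.of_subst hy hx ρ fun M => h ▸ LexLE.refl M _)

/-! ### Sequences generated by block substitutions -/

theorem repeated_succ (l : ℕ) (w : List ℕ) : repeated (l + 1) w = w ++ repeated l w := by
  simp [repeated, List.replicate_succ]

theorem map_repeated {φ : List ℕ → List ℕ} (h0 : φ [] = []) (h : ∀ x y, φ (x ++ y) = φ x ++ φ y)
    (l : ℕ) (w : List ℕ) : φ (repeated l w) = repeated l (φ w) := by
  induction l with
  | zero => simpa [repeated] using h0
  | succ l ih => rw [repeated_succ, repeated_succ, h, ih]

/-- Block substitutions commute with morphisms of the free monoid. -/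
theorem Rule.apply_map (ρ : Rule) {φ : List ℕ → List ℕ} (h0 : φ [] = [])
    (h : ∀ x y, φ (x ++ y) = φ x ++ φ y) (p : List ℕ × List ℕ) :
    ρ.apply (Prod.map φ φ p) = Prod.map φ φ (ρ.apply p) := by
  obtain ⟨A, B⟩ := p
  rcases ρ with ⟨l, hl⟩ | ⟨l, hl⟩ <;> simp [Rule.apply, h, map_repeated h0 h]

/-- The outermost substitution may be applied last, letter by letter. -/
theorem blocks_succ (r : ℕ → Rule) (n : ℕ) :
    blocks 0 r (n + 1) = Prod.map (List.flatMap (r 0).block) (List.flatMap (r 0).block)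
      (blocks 0 (fun i => r (i + 1)) n) := by
  induction n with
  | zero => simp [blocks, Rule.block]
  | succ n ih =>
    rw [blocks, ih, Rule.apply_map _ (by simp) (by simp)]
    rfl

theorem blocks_eq_map (m : ℕ) (r : ℕ → Rule) (n : ℕ) :
    blocks m r n = Prod.map (List.map (· + m)) (List.map (· + m)) (blocks 0 r n) := by
  induction n with
  | zero => simp [blocks, Nat.add_comm]
  | succ n ih => rw [blocks, ih, Rule.apply_map _ (by simp) (by simp)]; rfl

theorem exists_blocks_succ (m : ℕ) (r : ℕ → Rule) (n : ℕ) :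
    ∃ v, v ≠ [] ∧ (blocks m r (n + 1)).1 = (blocks m r n).1 ++ v := by
  have hB : ∀ n, (blocks m r n).2 ≠ [] := by
    intro n
    induction n with
    | zero => simp [blocks]
    | succ n ih =>
      rw [blocks]
      rcases r n with ⟨l, hl⟩ | ⟨l, hl⟩
      · simp [Rule.apply, ih]
      · simp [Rule.apply, repeated_succ, ih]
  rw [blocks]
  rcases r n with ⟨l, hl⟩ | ⟨l, hl⟩ <;> obtain ⟨l, rfl⟩ := Nat.exists_eq_add_of_le' hl
  · exact ⟨repeated (l + 1) (blocks m r n).1 ++ (blocks m r n).2, by simp [hB n],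
      by simp only [Rule.apply, repeated_succ, List.append_assoc]⟩
  · exact ⟨repeated (l + 1) (blocks m r n).2, by simp [repeated_succ, hB n], rfl⟩

theorem lt_length_blocks (m : ℕ) (r : ℕ → Rule) (n : ℕ) : n < (blocks m r n).1.length := by
  induction n with
  | zero => simp [blocks]
  | succ n ih =>
    obtain ⟨v, hv, h⟩ := exists_blocks_succ m r n
    have := List.length_pos_of_ne_nil hv
    rw [h, List.length_append]
    omega

theorem blocks_prefix (m : ℕ) (r : ℕ → Rule) {i n : ℕ} (h : i ≤ n) :
    (blocks m r i).1 <+: (blocks m r n).1 := by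
  induction n, h using Nat.le_induction with
  | base => exact List.prefix_refl _
  | succ n _ ih =>
    obtain ⟨v, -, h⟩ := exists_blocks_succ m r n
    exact ih.trans ⟨v, h.symm⟩

theorem map_range_eq_iff (w : List ℕ) (σ : Stream' ℕ) :
    (List.range w.length).map σ.get = w ↔ ∃ u, σ = w ++ₛ u := by
  constructor
  · intro h
    refine ⟨σ.drop w.length, ?_⟩
    have : σ.take w.length = w := by
      refine List.ext_getElem (by simp) fun i h1 h2 => ?_
      have h3 : ((List.range w.length).map σ.get)[i]'(by simpa using h2) = w[i] := by
        congr 1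
      rw [← h3]
      simp
    conv_lhs => rw [← Stream'.append_take_drop w.length σ, this]
  · rintro ⟨u, rfl⟩
    refine List.ext_getElem (by simp) fun i h1 h2 => ?_
    simp [Stream'.get_append_left _ _ _ h2]

theorem isGenerated_iff (m : ℕ) (r : ℕ → Rule) (σ : Stream' ℕ) :
    IsGenerated m r σ ↔ ∀ n, ∃ u, σ = (blocks m r n).1 ++ₛ u :=
  forall_congr' fun _ => map_range_eq_iff _ σ

theorem exists_isGenerated (m : ℕ) (r : ℕ → Rule) : ∃ σ : Stream' ℕ, IsGenerated m r σ := by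
  refine ⟨fun i => (blocks m r i).1[i]'(lt_length_blocks m r i), fun n => ?_⟩
  refine List.ext_getElem (by simp) fun i h1 h2 => ?_
  simp only [List.getElem_map, List.getElem_range]
  rcases le_total i n with h | h
  · exact (blocks_prefix m r h).getElem (lt_length_blocks m r i)
  · exact ((blocks_prefix m r h).getElem h2).symm

theorem IsGenerated.unique {m : ℕ} {r : ℕ → Rule} {σ σ' : Stream' ℕ} (h : IsGenerated m r σ)
    (h' : IsGenerated m r σ') : σ = σ' := by
  rw [isGenerated_iff] at h h'
  ext i
  obtain ⟨u, hu⟩ := h i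
  obtain ⟨u', hu'⟩ := h' i
  rw [hu, hu', Stream'.get_append_left _ _ _ (lt_length_blocks m r i),
    Stream'.get_append_left _ _ _ (lt_length_blocks m r i)]

theorem isGenerated_add_iff (m : ℕ) (r : ℕ → Rule) (σ : Stream' ℕ) :
    IsGenerated m r (σ.map (· + m)) ↔ IsGenerated 0 r σ := by
  refine forall_congr' fun n => ?_
  rw [blocks_eq_map]
  simp only [Prod.map_fst, List.length_map]
  have : (List.range (blocks 0 r n).1.length).map (fun i => σ.get i + m) =
      ((List.range (blocks 0 r n).1.length).map σ.get).map (· + m) := by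
    rw [List.map_map]; rfl
  change (List.range (blocks 0 r n).1.length).map (fun i => σ.get i + m) = _ ↔ _
  rw [this]
  exact (List.map_injective_iff.2 (add_left_injective m)).eq_iff

theorem subst_append (ρ : Rule) (w : List ℕ) (x : Stream' ℕ) :
    subst ρ (w ++ₛ x) = w.flatMap ρ.block ++ₛ subst ρ x := by
  induction w with
  | nil => rfl
  | cons d w ih =>
    rw [Stream'.cons_append_stream, subst_cons, ih, List.flatMap_cons,
      Stream'.append_append_stream]

/-- The substitution `r 0` maps the sequence generated by `r 1, r 2, …` to the sequence generated by
`r 0, r 1, …`. -/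
theorem IsGenerated.subst {r : ℕ → Rule} {σ : Stream' ℕ}
    (h : IsGenerated 0 (fun i => r (i + 1)) σ) : IsGenerated 0 r (subst (r 0) σ) := by
  rw [isGenerated_iff] at h ⊢
  intro n
  cases n with
  | zero =>
    obtain ⟨u, hu⟩ := exists_subst_eq_cons (r 0) σ
    exact ⟨u, hu⟩
  | succ n =>
    obtain ⟨u, hu⟩ := h n
    refine ⟨ABCF.subst (r 0) u, ?_⟩
    rw [blocks_succ]
    conv_lhs => rw [hu, subst_append]
    rfl

theorem IsGenerated.exists_eq_subst {r : ℕ → Rule} {σ : Stream' ℕ} (h : IsGenerated 0 r σ) :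
    ∃ σ', IsGenerated 0 (fun i => r (i + 1)) σ' ∧ σ = ABCF.subst (r 0) σ' := by
  obtain ⟨σ', hσ'⟩ := exists_isGenerated 0 (fun i => r (i + 1))
  exact ⟨σ', hσ', h.unique hσ'.subst⟩

/-- `σ` is generated from the letters `0`, `1` by some choice of block substitutions. -/
def Gen (σ : Stream' ℕ) : Prop := ∃ r, IsGenerated 0 r σ

theorem Gen.exists_eq_subst {σ : Stream' ℕ} (h : Gen σ) : ∃ ρ σ', Gen σ' ∧ σ = subst ρ σ' := by
  obtain ⟨r, hr⟩ := h
  obtain ⟨σ', h, h'⟩ := hr.exists_eq_subst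
  exact ⟨r 0, σ', ⟨_, h⟩, h'⟩

theorem Gen.get_zero {σ : Stream' ℕ} (h : Gen σ) : σ.get 0 = 0 := by
  obtain ⟨ρ, σ', -, rfl⟩ := h.exists_eq_subst
  obtain ⟨u, hu⟩ := exists_subst_eq_cons ρ σ'
  rw [hu]; rfl

theorem Gen.binary {σ : Stream' ℕ} (h : Gen σ) : Binary σ := by
  obtain ⟨ρ, σ', -, rfl⟩ := h.exists_eq_subst
  exact binary_subst ρ σ'

/-- The sequence `1w`, for a sequence `x = 0w`. -/
def top (x : Stream' ℕ) : Stream' ℕ := Stream'.cons 1 x.tail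

theorem Binary.top {x : Stream' ℕ} (h : Binary x) : Binary (top x) := by
  intro i
  cases i with
  | zero => exact le_rfl
  | succ i => exact h (i + 1)

theorem eq_cons_tail (x : Stream' ℕ) {a : ℕ} (h : x.get 0 = a) : x = Stream'.cons a x.tail := by
  subst h; exact (Stream'.eta x).symm

/-- A substitution of the first kind takes upper bounds of tails to upper bounds of tails, up to an
initial `1`, with which it ends every block. -/
theorem top_subst_caseA (l : ℕ) (hl : 2 ≤ l) {x : Stream' ℕ} (hx : x.get 0 = 0) :
    top (subst (Rule.caseA l hl) x) = Stream'.cons 1 (subst (Rule.caseA l hl) (top x)) := by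
  obtain ⟨k, rfl⟩ : ∃ k, l = k + 1 := ⟨l - 1, by omega⟩
  rw [subst_eq, hx, Rule.block_caseA_zero, top, top, subst_cons,
    Rule.block_caseA_one _ _ one_ne_zero]
  rfl

/-- A substitution of the second kind takes upper bounds of tails to upper bounds of tails, up to an
initial `0`, with which it starts every block. -/
theorem top_subst_caseB (l : ℕ) (hl : 1 ≤ l) {x : Stream' ℕ} (hx : x.get 0 = 0) :
    Stream'.cons 0 (top (subst (Rule.caseB l hl) x)) = subst (Rule.caseB l hl) (top x) := by
  rw [subst_eq, hx, Rule.block_caseB_zero, top, top, subst_cons,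
    Rule.block_caseB_one _ _ one_ne_zero]
  rfl

/-- The sequence `σ = 0w` in the letters `0`, `1` satisfies `0w ≤ σ' ≤ 1w` for each of its tails
`σ'`, in the lexicographic order. -/
structure Adm (σ : Stream' ℕ) : Prop where
  binary : Binary σ
  get_zero : σ.get 0 = 0
  lower : ∀ k N, LexLE N σ (σ.drop k)
  upper : ∀ k N, LexLE N (σ.drop k) (top σ)

theorem eq_replicate_of_append_eq {u v : List ℕ} {n a b : ℕ}
    (h : List.replicate n a ++ [b] = u ++ v) (hv : v ≠ []) :
    v = List.replicate (n - u.length) a ++ [b] ∧ u.length ≤ n := by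
  have h1 := congrArg (List.drop u.length) h
  have h2 := congrArg List.length h
  have h3 := List.length_pos_of_ne_nil hv
  simp only [List.length_append, List.length_replicate, List.length_singleton] at h2
  have h4 : u.length ≤ n := by omega
  refine ⟨?_, h4⟩
  rw [List.drop_left, List.drop_append_of_le_length (by simpa using h4), List.drop_replicate] at h1
  exact h1.symm

theorem eq_replicate_of_cons_eq {u v : List ℕ} {n a b : ℕ}
    (h : b :: List.replicate n a = u ++ v) (hu : u ≠ []) :
    ∃ i ≤ n, v = List.replicate i a ∧ (i = n → u = [b]) := by
  obtain ⟨c, u, rfl⟩ := List.exists_cons_of_ne_nil hu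
  rw [List.cons_append, List.cons.injEq] at h
  obtain ⟨rfl, h⟩ := h
  have h2 := congrArg List.length h
  simp only [List.length_append, List.length_replicate] at h2
  have h1 := congrArg (List.drop u.length) h
  rw [List.drop_left, List.drop_replicate] at h1
  refine ⟨n - u.length, by omega, h1.symm, fun h3 => ?_⟩
  have : u.length = 0 := by omega
  simpa using this

/-- Monotonicity of the last substitution improves an agreement up to the index `N` by at least one
letter; tails that start inside a block are compared directly. -/
theorem Gen.lexLE {σ : Stream' ℕ} (h : Gen σ) (N : ℕ) :
    ∀ k, LexLE N σ (σ.drop k) ∧ LexLE N (σ.drop k) (top σ) := by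
  induction N generalizing σ with
  | zero => exact fun k => ⟨trivial, trivial⟩
  | succ N ih =>
    intro k
    obtain ⟨ρ, x, hx, rfl⟩ := h.exists_eq_subst
    obtain ⟨j, u, v, hv, huv, hd⟩ := drop_subst ρ x k
    rw [hd]
    have lower : u = [] → LexLE (N + 1) (subst ρ x) (v ++ₛ subst ρ (x.drop (j + 1))) := by
      rintro rfl
      have h1 := ((ih hx j).1.subst hx.binary (hx.binary.drop j) ρ).of_le
        (show N + 1 ≤ 2 * N + 1 by omega)
      have h2 : (x.drop j).get 0 = x.get j := by simp [Stream'.get_drop]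
      rw [subst_eq ρ (x.drop j), h2, Stream'.tail_drop'] at h1
      rw [List.nil_append] at huv
      rwa [← huv]
    rcases ρ with ⟨l, hl⟩ | ⟨l, hl⟩
    · obtain ⟨n, hn, hn'⟩ : ∃ n ≤ l, (Rule.caseA l hl).block (x.get j) =
          List.replicate n 0 ++ [1] := by
        by_cases hd : x.get j = 0
        · exact ⟨l, le_rfl, by rw [hd, Rule.block_caseA_zero]⟩
        · exact ⟨l - 1, by omega, by rw [Rule.block_caseA_one _ _ hd]⟩
      rw [hn'] at huv
      obtain ⟨rfl, hun⟩ := eq_replicate_of_append_eq huv hv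
      constructor
      · rcases eq_or_ne u [] with h1 | h1
        · exact lower h1
        · have h2 := List.length_pos_of_ne_nil h1
          obtain ⟨q, hq⟩ : ∃ q, l = (n - u.length) + (q + 1) :=
            ⟨l - (n - u.length) - 1, by omega⟩
          have hrep : List.replicate l 0 =
              List.replicate (n - u.length) 0 ++ List.replicate (q + 1) 0 := by
            rw [← List.replicate_add, ← hq]
          rw [subst_eq _ x, hx.get_zero, Rule.block_caseA_zero, Stream'.append_append_stream,
            Stream'.append_append_stream, hrep, Stream'.append_append_stream]
          exact lexLE_append_of_lt _ _ Nat.zero_lt_one _ _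
      · rcases Nat.eq_zero_or_pos (n - u.length) with h1 | h1
        · rw [h1, top_subst_caseA l hl hx.get_zero]
          change LexLE (N + 1) (Stream'.cons 1 _) _
          rw [lexLE_cons_self]
          exact ((ih hx (j + 1)).2.subst (hx.binary.drop _) hx.binary.top _).of_le (by omega)
        · obtain ⟨q, hq⟩ : ∃ q, n - u.length = q + 1 := ⟨n - u.length - 1, by omega⟩
          rw [hq]
          exact lexLE_cons_of_lt _ Nat.zero_lt_one _ _
    · obtain ⟨n, hn, hn'⟩ : ∃ n, (n = l ∨ n = l + 1 ∧ x.get j ≠ 0) ∧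
          (Rule.caseB l hl).block (x.get j) = 0 :: List.replicate n 1 := by
        by_cases hd : x.get j = 0
        · exact ⟨l, Or.inl rfl, by rw [hd, Rule.block_caseB_zero]⟩
        · exact ⟨l + 1, Or.inr ⟨rfl, hd⟩, by rw [Rule.block_caseB_one _ _ hd]⟩
      rcases eq_or_ne u [] with h1 | h1
      · refine ⟨lower h1, ?_⟩
        rw [h1, List.nil_append, hn'] at huv
        rw [← huv]
        exact lexLE_cons_of_lt _ Nat.zero_lt_one _ _
      · rw [hn'] at huv
        obtain ⟨i, hi, rfl, hi'⟩ := eq_replicate_of_cons_eq huv h1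
        obtain ⟨q, rfl⟩ : ∃ q, i = q + 1 := by
          refine Nat.exists_eq_succ_of_ne_zero ?_
          rintro rfl
          simp at hv
        constructor
        · obtain ⟨z, hz⟩ := exists_subst_eq_cons (Rule.caseB l hl) x
          rw [hz]
          exact lexLE_cons_of_lt _ Nat.zero_lt_one _ _
        · have htop : top (subst (Rule.caseB l hl) x) =
              List.replicate (l + 1) 1 ++ₛ subst (Rule.caseB l hl) x.tail := by
            rw [subst_eq, hx.get_zero, Rule.block_caseB_zero]
            rfl
          rw [htop]
          rcases Nat.lt_or_ge l (q + 1) with h2 | h2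
          · have h3 : n = l + 1 ∧ x.get j ≠ 0 := by omega
            have h4 : (x.drop j).get 0 = 1 := by
              have := hx.binary j
              have h5 : (x.drop j).get 0 = x.get j := by simp [Stream'.get_drop]
              omega
            have h5 := (ih hx j).2
            have h6 : q + 1 = l + 1 := by omega
            rw [h6]
            cases N with
            | zero =>
              change LexLE 1 (Stream'.cons 1 _) (Stream'.cons 1 _)
              rw [lexLE_cons_self]
              trivial
            | succ M =>
              rw [eq_cons_tail _ h4, top, lexLE_cons_self] at h5
              have h7 := h5.subst (hx.binary.drop j).tail hx.binary.tail (Rule.caseB l hl)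
              rw [Stream'.tail_drop'] at h7
              refine LexLE.of_le ?_ ((lexLE_append (List.replicate (l + 1) 1)).2 h7)
              simp
              omega
          · obtain ⟨p, rfl⟩ : ∃ p, l = q + 1 + p := ⟨l - (q + 1), by omega⟩
            obtain ⟨z, hz⟩ := exists_subst_eq_cons (Rule.caseB (q + 1 + p) hl) (x.drop (j + 1))
            have hrep : List.replicate (q + 1 + p + 1) 1 =
                List.replicate (q + 1) 1 ++ List.replicate (p + 1) 1 := by
              rw [← List.replicate_add, add_assoc]
            rw [hz, hrep, Stream'.append_append_stream]
            exact lexLE_append_of_lt _ _ Nat.zero_lt_one _ _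

theorem Gen.adm {σ : Stream' ℕ} (h : Gen σ) : Adm σ :=
  ⟨h.binary, h.get_zero, fun k N => (h.lexLE N k).1, fun k N => (h.lexLE N k).2⟩

/-- `x` and `y` have the same first `N` entries. -/
def Agree (N : ℕ) (x y : Stream' ℕ) : Prop := LexLE N x y ∧ LexLE N y x

theorem Agree.of_le {M N : ℕ} (h : M ≤ N) {x y : Stream' ℕ} (hxy : Agree N x y) : Agree M x y :=
  ⟨hxy.1.of_le h, hxy.2.of_le h⟩

theorem Agree.subst {N : ℕ} {x y : Stream' ℕ} (hx : Binary x) (hy : Binary y) (h : Agree N x y)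
    (ρ : Rule) : Agree (2 * N + 1) (subst ρ x) (subst ρ y) :=
  ⟨h.1.subst hx hy ρ, h.2.subst hy hx ρ⟩

theorem agree_cons_self {N a : ℕ} {x y : Stream' ℕ} :
    Agree (N + 1) (Stream'.cons a x) (Stream'.cons a y) ↔ Agree N x y := by
  simp [Agree, lexLE_cons_self]

/-- Generated sequences are recurrent. -/
theorem Gen.exists_agree_self {σ : Stream' ℕ} (h : Gen σ) (N : ℕ) :
    ∃ k, 1 ≤ k ∧ Agree N (σ.drop k) σ := by
  induction N generalizing σ with
  | zero => exact ⟨1, le_rfl, trivial, trivial⟩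
  | succ N ih =>
    obtain ⟨ρ, x, hx, rfl⟩ := h.exists_eq_subst
    obtain ⟨j, hj, hjN⟩ := ih hx
    obtain ⟨k, hk, hkj⟩ := exists_drop_subst ρ x j
    refine ⟨k, hj.trans hk, ?_⟩
    rw [hkj]
    exact (hjN.subst (hx.binary.drop j) hx.binary ρ).of_le (by omega)

/-- The upper bound `1w` of the tails of a generated sequence `0w` is a limit of tails. -/
theorem Gen.exists_agree_top {σ : Stream' ℕ} (h : Gen σ) (N : ℕ) :
    ∃ k, Agree (N + 1) (σ.drop k) (top σ) := by
  induction N generalizing σ with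
  | zero =>
    obtain ⟨ρ, x, hx, rfl⟩ := h.exists_eq_subst
    obtain ⟨n, u, hu⟩ : ∃ (n : ℕ) (u : Stream' ℕ),
        ABCF.subst ρ x = List.replicate n 0 ++ₛ Stream'.cons 1 u := by
      rw [subst_eq, hx.get_zero]
      rcases ρ with ⟨l, hl⟩ | ⟨l, hl⟩
      · rw [Rule.block_caseA_zero, Stream'.append_append_stream]
        exact ⟨l, _, rfl⟩
      · obtain ⟨l, rfl⟩ := Nat.exists_eq_add_of_le' hl
        rw [Rule.block_caseB_zero, List.replicate_succ]
        exact ⟨1, _, rfl⟩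
    have h3 := Stream'.drop_append_stream (List.replicate n 0) (Stream'.cons 1 u)
    rw [List.length_replicate, ← hu] at h3
    refine ⟨n, ?_⟩
    rw [h3, top, agree_cons_self]
    exact ⟨trivial, trivial⟩
  | succ N ih =>
    obtain ⟨ρ, x, hx, rfl⟩ := h.exists_eq_subst
    obtain ⟨j, hj⟩ := ih hx
    have h1 := hj.subst (hx.binary.drop j) hx.binary.top ρ
    rcases ρ with ⟨l, hl⟩ | ⟨l, hl⟩
    · obtain ⟨i, rfl⟩ : ∃ i, j = i + 1 := by
        refine Nat.exists_eq_succ_of_ne_zero ?_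
        rintro rfl
        have := hj.1.get_eq hj.2 0 (by omega)
        rw [Stream'.drop_zero, hx.get_zero] at this
        simp [top, Stream'.get, Stream'.cons] at this
      obtain ⟨k, hk⟩ := exists_drop_subst_caseA l hl x i
      refine ⟨k, ?_⟩
      rw [hk, top_subst_caseA l hl hx.get_zero, agree_cons_self]
      exact h1.of_le (by omega)
    · obtain ⟨k, -, hk⟩ := exists_drop_subst (Rule.caseB l hl) x j
      refine ⟨k + 1, ?_⟩
      obtain ⟨u, hu⟩ := exists_subst_eq_cons (Rule.caseB l hl) (x.drop j)
      rw [← top_subst_caseB l hl hx.get_zero, hu, agree_cons_self] at h1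
      rw [← Stream'.drop_drop, hk, hu]
      exact h1.of_le (by omega)

theorem eventuallyPeriodic_iff (x : Stream' ℕ) :
    EventuallyPeriodic x ↔ ∃ N p, 0 < p ∧ x.drop (N + p) = x.drop N := by
  refine exists_congr fun N => exists_congr fun p => and_congr_right fun _ => ⟨fun h => ?_, ?_⟩
  · ext i
    rw [Stream'.get_drop, Stream'.get_drop, add_right_comm]
    exact h (N + i) (Nat.le_add_right N i)
  · intro h i hi
    obtain ⟨j, rfl⟩ := Nat.exists_eq_add_of_le hi
    have := congrArg (fun s => Stream'.get s j) h
    simp only [Stream'.get_drop] at this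
    rwa [add_right_comm] at this

/-- An eventually periodic sequence has finitely many tails, so that a limit of tails is a tail. -/
theorem exists_drop_eq_of_agree {x y : Stream' ℕ} (hx : EventuallyPeriodic x)
    (h : ∀ N, ∃ k, 1 ≤ k ∧ Agree N (x.drop k) y) : ∃ k, 1 ≤ k ∧ x.drop k = y := by
  obtain ⟨M, p, hp, hMp⟩ := (eventuallyPeriodic_iff x).1 hx
  have red : ∀ k, 1 ≤ k → ∃ i, 1 ≤ i ∧ i ≤ M + p ∧ x.drop i = x.drop k := by
    intro k
    induction k using Nat.strong_induction_on with
    | _ k ih =>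
      intro hk
      rcases Nat.lt_or_ge (M + p) k with h1 | h1
      · obtain ⟨i, hi, hi', hik⟩ := ih (k - p) (by omega) (by omega)
        refine ⟨i, hi, hi', hik.trans ?_⟩
        obtain ⟨q, rfl⟩ := Nat.exists_eq_add_of_lt h1
        rw [show M + p + q + 1 - p = M + (q + 1) by omega, ← Stream'.drop_drop, ← hMp,
          Stream'.drop_drop, add_assoc (M + p)]
      · exact ⟨k, hk, h1, rfl⟩
  by_contra! hne
  have hfin : ∀ i, ∃ N, 1 ≤ i → ¬ Agree N (x.drop i) y := by
    intro i
    by_contra! h1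
    exact hne i (h1 0).1 (LexLE.antisymm (fun N => (h1 N).2.1) fun N => (h1 N).2.2)
  choose N hN using hfin
  obtain ⟨k, hk, hka⟩ := h ((Finset.range (M + p + 1)).sup N)
  obtain ⟨i, hi, hi', hik⟩ := red k hk
  refine hN i hi ?_
  rw [hik]
  exact hka.of_le (Finset.le_sup (Finset.mem_range.2 (by omega)))

/-- If `σ = 0w` were eventually periodic, then the limits `0w` and `1w` of its tails would both
belong to one cycle of the shift, which is injective on it. -/
theorem Gen.not_eventuallyPeriodic {σ : Stream' ℕ} (h : Gen σ) : ¬ EventuallyPeriodic σ := by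
  intro hp
  obtain ⟨p, hp1, hpσ⟩ := exists_drop_eq_of_agree hp h.exists_agree_self
  obtain ⟨k, -, hk⟩ := exists_drop_eq_of_agree (y := top σ) hp fun N => by
    obtain ⟨k, hk⟩ := h.exists_agree_top N
    refine ⟨k, Nat.one_le_iff_ne_zero.2 ?_, hk.of_le (Nat.le_succ N)⟩
    rintro rfl
    have := hk.1.get_eq hk.2 0 (by omega)
    rw [Stream'.drop_zero, h.get_zero] at this
    simp [top, Stream'.get, Stream'.cons] at this
  obtain ⟨q, rfl⟩ := Nat.exists_eq_add_of_le' hp1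
  have h1 : σ.drop (k + 1) = σ.drop 1 := by
    rw [← Stream'.drop_drop, hk]; rfl
  have h2 : σ.drop (k + (q + 1)) = σ := by
    rw [show k + (q + 1) = k + 1 + q by omega, ← Stream'.drop_drop, h1, Stream'.drop_drop,
      add_comm, hpσ]
  have h3 : σ.drop (k + (q + 1)) = σ.drop k := by
    rw [add_comm, ← Stream'.drop_drop, hpσ]
  rw [h2, hk] at h3
  have h4 := h.get_zero
  rw [h3] at h4
  simp [top, Stream'.get, Stream'.cons] at h4

/-! ### Desubstitution -/

/-- If every sequence of a class starts with a block, and what remains belongs to the class again,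
then the sequences of the class are images under the substitution. -/
theorem exists_eq_subst_of_forall (ρ : Rule) {P : Stream' ℕ → Prop}
    (hP : ∀ z, P z → ∃ d z', d ≤ 1 ∧ P z' ∧ z = ρ.block d ++ₛ z') {z : Stream' ℕ} (hz : P z) :
    ∃ x, Binary x ∧ z = subst ρ x := by
  have hP' : ∀ s : {z // P z}, ∃ (d : ℕ) (t : {z // P z}), d ≤ 1 ∧ s.1 = ρ.block d ++ₛ t.1 := by
    intro s
    obtain ⟨d, z', hd, hz', h⟩ := hP s.1 s.2
    exact ⟨d, ⟨z', hz'⟩, hd, h⟩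
  choose d nx hd hnx using hP'
  set s : ℕ → {z // P z} := fun n => nx^[n] ⟨z, hz⟩ with hs
  have hs1 : ∀ n, s (n + 1) = nx (s n) := fun n => Function.iterate_succ_apply' nx n _
  set x : Stream' ℕ := fun n => d (s n) with hx
  refine ⟨x, fun i => hd (s i), ?_⟩
  have key : ∀ k n, (s n).1.get k = (subst ρ (x.drop n)).get k := by
    intro k
    induction k using Nat.strong_induction_on with
    | _ k ih =>
      intro n
      have hx0 : (x.drop n).get 0 = d (s n) := by
        rw [Stream'.get_drop]; rfl
      rw [hnx (s n), subst_eq, hx0, Stream'.tail_drop']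
      rcases Nat.lt_or_ge k (ρ.block (d (s n))).length with h | h
      · rw [Stream'.get_append_left _ _ _ h, Stream'.get_append_left _ _ _ h]
      · obtain ⟨j, rfl⟩ := Nat.exists_eq_add_of_le h
        have h2 := ρ.two_le_length_block (d (s n))
        rw [Stream'.get_append_right, Stream'.get_append_right, ← hs1]
        exact ih j (by omega) (n + 1)
  exact Stream'.ext fun k => key k 0

theorem exists_eq_replicate_append {z : Stream' ℕ} {c i : ℕ} (h : z.get i ≠ c) :
    ∃ p e u, e ≠ c ∧ z = List.replicate p c ++ₛ Stream'.cons e u := by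
  induction i generalizing z with
  | zero => exact ⟨0, _, z.tail, h, eq_cons_tail z rfl⟩
  | succ i ih =>
    obtain ⟨p, e, u, he, hz⟩ := ih (z := z.tail) h
    by_cases h0 : z.get 0 = c
    · exact ⟨p + 1, e, u, he, (eq_cons_tail z h0).trans (by rw [hz]; rfl)⟩
    · exact ⟨0, _, z.tail, h0, eq_cons_tail z rfl⟩

theorem lexLE_tail {a : ℕ} {x y : Stream' ℕ}
    (h : ∀ N, LexLE N (Stream'.cons a x) (Stream'.cons a y)) (N : ℕ) : LexLE N x y :=
  lexLE_cons_self.1 (h (N + 1))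

theorem get_zero_le_of_lexLE {x y : Stream' ℕ} (h : ∀ N, LexLE N x y) : x.get 0 ≤ y.get 0 := by
  rcases h 1 with h | h
  · exact h.le
  · exact h.1.le

/-- A sequence of letters `0`, `1` between `0^(q+1) 1 ⋯` and `0^q 1 ⋯` starts with one of these two
blocks. -/
theorem exists_eq_replicate_zero {q : ℕ} {u v z : Stream' ℕ} (hz : Binary z)
    (h1 : ∀ N, LexLE N (List.replicate (q + 1) 0 ++ₛ Stream'.cons 1 u) z)
    (h2 : ∀ N, LexLE N z (List.replicate q 0 ++ₛ Stream'.cons 1 v)) :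
    ∃ z', z = List.replicate (q + 1) 0 ++ₛ Stream'.cons 1 z' ∨
      z = List.replicate q 0 ++ₛ Stream'.cons 1 z' := by
  induction q generalizing z with
  | zero =>
    refine ⟨if z.get 0 = 0 then z.tail.tail else z.tail, ?_⟩
    by_cases h0 : z.get 0 = 0
    · left
      have hz' := eq_cons_tail z h0
      rw [hz'] at h1
      have h4 : 1 ≤ z.tail.get 0 := get_zero_le_of_lexLE (lexLE_tail h1)
      have h5 : z.tail.get 0 = 1 := le_antisymm (hz.tail 0) h4
      rw [if_pos h0]
      refine hz'.trans ?_
      rw [eq_cons_tail z.tail h5]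
      rfl
    · right
      rw [if_neg h0]
      exact eq_cons_tail z (by have := hz 0; omega)
  | succ q ih =>
    have h4 := get_zero_le_of_lexLE h2
    have h5 : z.get 0 = 0 := Nat.le_zero.1 h4
    have hz' := eq_cons_tail z h5
    rw [hz'] at h1 h2
    obtain ⟨z', h6⟩ := ih hz.tail (lexLE_tail h1) (lexLE_tail h2)
    refine ⟨z', ?_⟩
    rcases h6 with h6 | h6
    · left
      refine hz'.trans ?_
      rw [h6]; rfl
    · right
      refine hz'.trans ?_
      rw [h6]; rfl

/-- A sequence of letters `0`, `1` between `1^l 0 ⋯` and `1^(l+1) 0 ⋯` starts with one of these two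
blocks. -/
theorem exists_eq_replicate_one {l : ℕ} {u v z : Stream' ℕ} (hz : Binary z)
    (h1 : ∀ N, LexLE N (List.replicate l 1 ++ₛ Stream'.cons 0 u) z)
    (h2 : ∀ N, LexLE N z (List.replicate (l + 1) 1 ++ₛ Stream'.cons 0 v)) :
    ∃ z', z = List.replicate l 1 ++ₛ Stream'.cons 0 z' ∨
      z = List.replicate (l + 1) 1 ++ₛ Stream'.cons 0 z' := by
  induction l generalizing z with
  | zero =>
    refine ⟨if z.get 0 = 0 then z.tail else z.tail.tail, ?_⟩
    by_cases h0 : z.get 0 = 0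
    · left
      rw [if_pos h0]
      exact eq_cons_tail z h0
    · right
      have hz' := eq_cons_tail z (a := 1) (by have := hz 0; omega)
      rw [hz'] at h2
      have h4 := get_zero_le_of_lexLE (lexLE_tail h2)
      rw [if_neg h0]
      refine hz'.trans ?_
      rw [eq_cons_tail z.tail (a := 0) (Nat.le_zero.1 h4)]
      rfl
  | succ l ih =>
    have h4 : 1 ≤ z.get 0 := get_zero_le_of_lexLE h1
    have hz' := eq_cons_tail z (a := 1) (by have := hz 0; omega)
    rw [hz'] at h1 h2
    obtain ⟨z', h6⟩ := ih hz.tail (lexLE_tail h1) (lexLE_tail h2)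
    refine ⟨z', ?_⟩
    rcases h6 with h6 | h6
    · left
      refine hz'.trans ?_
      rw [h6]; rfl
    · right
      refine hz'.trans ?_
      rw [h6]; rfl

theorem drop_eq_of_append {σ z' : Stream' ℕ} {k : ℕ} {w : List ℕ} (h : σ.drop k = w ++ₛ z') :
    σ.drop (k + w.length) = z' := by
  rw [← Stream'.drop_drop, h, Stream'.drop_append_stream]

theorem Adm.exists_subst_caseA {σ u : Stream' ℕ} (h : Adm σ) {q : ℕ}
    (hσ : σ = List.replicate (q + 2) 0 ++ₛ Stream'.cons 1 u) :
    ∃ ρ x, Binary x ∧ x.get 0 = 0 ∧ σ = subst ρ x := by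
  set ρ : Rule := Rule.caseA (q + 2) (by omega) with hρ
  set P : Stream' ℕ → Prop := fun z =>
    ∃ k, z = σ.drop k ∧ ∀ N, LexLE N z (List.replicate (q + 1) 0 ++ₛ Stream'.cons 1 u) with hPdef
  have htop : top σ = Stream'.cons 1 (List.replicate (q + 1) 0 ++ₛ Stream'.cons 1 u) := by
    rw [top, hσ]; rfl
  -- what follows a letter `1` is at most `w`, where `σ = 0w`
  have after : ∀ k z, σ.drop k = Stream'.cons 1 z → P z := by
    intro k z hk
    refine ⟨k + 1, ?_, ?_⟩
    · rw [← Stream'.drop_drop, hk]; rfl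
    · intro N
      have := h.upper k (N + 1)
      rwa [hk, htop, lexLE_cons_self] at this
  have after' : ∀ k z n, σ.drop k = List.replicate n 0 ++ₛ Stream'.cons 1 z → P z := by
    intro k z n hk
    exact after _ z (drop_eq_of_append hk)
  have hb0 : ρ.block 0 = List.replicate (q + 2) 0 ++ [1] := Rule.block_caseA_zero _ _
  have hb1 : ρ.block 1 = List.replicate (q + 1) 0 ++ [1] :=
    Rule.block_caseA_one _ _ one_ne_zero
  obtain ⟨x, hx, hux⟩ := exists_eq_subst_of_forall ρ (P := P) (z := u) (by
    rintro z ⟨k, rfl, hle⟩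
    have hlow := h.lower k
    obtain ⟨z', hz' | hz'⟩ := exists_eq_replicate_zero (h.binary.drop k)
      (fun N => by rw [← hσ]; exact hlow N) hle
    · refine ⟨0, z', by omega, after' k z' _ hz', ?_⟩
      rw [hz', hb0, Stream'.append_append_stream]; rfl
    · refine ⟨1, z', by omega, after' k z' _ hz', ?_⟩
      rw [hz', hb1, Stream'.append_append_stream]; rfl) (after' 0 u _ hσ)
  refine ⟨ρ, Stream'.cons 0 x, ?_, rfl, ?_⟩
  · intro i
    cases i with
    | zero => exact Nat.zero_le _
    | succ i => exact hx i
  · rw [subst_cons, ← hux, hb0, Stream'.append_append_stream, hσ]; rfl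

theorem Adm.exists_subst_caseB {σ u : Stream' ℕ} (h : Adm σ) {l : ℕ} (hl : 1 ≤ l)
    (hσ : σ = Stream'.cons 0 (List.replicate l 1 ++ₛ Stream'.cons 0 u)) :
    ∃ ρ x, Binary x ∧ x.get 0 = 0 ∧ σ = subst ρ x := by
  set ρ : Rule := Rule.caseB l hl with hρ
  set P : Stream' ℕ → Prop := fun z => ∃ k z', z = σ.drop k ∧ z = Stream'.cons 0 z' with hPdef
  have htop : top σ = List.replicate (l + 1) 1 ++ₛ Stream'.cons 0 u := by
    rw [top, hσ]; rfl
  have hb0 : ρ.block 0 = 0 :: List.replicate l 1 := Rule.block_caseB_zero _ _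
  have hb1 : ρ.block 1 = 0 :: List.replicate (l + 1) 1 := Rule.block_caseB_one _ _ one_ne_zero
  have after : ∀ k n z, σ.drop k = (0 :: List.replicate n 1) ++ₛ Stream'.cons 0 z →
      P (Stream'.cons 0 z) := by
    intro k n z hk
    exact ⟨_, z, (drop_eq_of_append hk).symm, rfl⟩
  obtain ⟨x, hx, hux⟩ := exists_eq_subst_of_forall ρ (P := P) (z := Stream'.cons 0 u) (by
    rintro z ⟨k, z1, rfl, hz1⟩
    have hlow := h.lower k
    rw [hz1] at hlow
    conv at hlow => ext N; arg 2; rw [hσ]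
    have hd : σ.drop (k + 1) = z1 := by
      rw [← Stream'.drop_drop, hz1]; rfl
    have hup := h.upper (k + 1)
    have hbin := h.binary.drop (k + 1)
    rw [hd] at hup hbin
    rw [htop] at hup
    obtain ⟨z', hz' | hz'⟩ := exists_eq_replicate_one hbin (lexLE_tail hlow) hup
    · have h6 : σ.drop k = (0 :: List.replicate l 1) ++ₛ Stream'.cons 0 z' := by
        rw [hz1, hz']; rfl
      exact ⟨0, Stream'.cons 0 z', by omega, after k _ z' h6, by rw [h6, hb0]⟩
    · have h6 : σ.drop k = (0 :: List.replicate (l + 1) 1) ++ₛ Stream'.cons 0 z' := by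
        rw [hz1, hz']; rfl
      exact ⟨1, Stream'.cons 0 z', by omega, after k _ z' h6, by rw [h6, hb1]⟩)
    (after 0 l u hσ)
  refine ⟨ρ, Stream'.cons 0 x, ?_, rfl, ?_⟩
  · intro i
    cases i with
    | zero => exact Nat.zero_le _
    | succ i => exact hx i
  · rw [subst_cons, ← hux, hb0, hσ]; rfl

/-- The length of the first run of zeros, and then of the first run of ones, tells which block
substitution to undo. -/
theorem Adm.exists_eq_subst {σ : Stream' ℕ} (h : Adm σ) (hp : ¬ EventuallyPeriodic σ) :
    ∃ ρ x, Binary x ∧ x.get 0 = 0 ∧ σ = subst ρ x := by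
  have hne : ∀ k c, ∃ i, (σ.drop k).get i ≠ c := by
    intro k c
    by_contra! hc
    refine hp ((eventuallyPeriodic_iff σ).2 ⟨k, 1, one_pos, ?_⟩)
    ext i
    have h1 := hc i
    have h2 := hc (i + 1)
    rw [Stream'.get_drop] at h1 h2 ⊢
    rw [Stream'.get_drop, h1, ← h2]
    congr 1
    omega
  obtain ⟨i, hi⟩ := hne 0 0
  obtain ⟨p, e, u, he, hσ⟩ := exists_eq_replicate_append hi
  rw [Stream'.drop_zero] at hσ
  have hd := drop_eq_of_append (σ := σ) (k := 0) hσ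
  have he1 : e = 1 := by
    have h1 := h.binary.drop (0 + (List.replicate p 0).length) 0
    rw [hd] at h1
    have : (Stream'.cons e u).get 0 = e := rfl
    omega
  subst he1
  obtain rfl | rfl | ⟨q, rfl⟩ : p = 0 ∨ p = 1 ∨ ∃ q, p = q + 2 := by
    rcases p with _ | _ | q
    · simp
    · simp
    · exact Or.inr (Or.inr ⟨q, rfl⟩)
  · have h0 := h.get_zero
    rw [hσ] at h0
    exact absurd h0 one_ne_zero
  · obtain ⟨i, hi⟩ := hne 1 1
    obtain ⟨l, e, v, he, hσ'⟩ := exists_eq_replicate_append hi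
    have hd' := drop_eq_of_append hσ'
    have he0 : e = 0 := by
      have h1 := h.binary.drop (1 + (List.replicate l 1).length) 0
      rw [hd'] at h1
      have : (Stream'.cons e v).get 0 = e := rfl
      omega
    subst he0
    have hl : 1 ≤ l := by
      refine Nat.one_le_iff_ne_zero.2 ?_
      rintro rfl
      have h1 := congrArg (fun s => Stream'.get s 0) (hd.symm.trans hσ')
      exact absurd h1 one_ne_zero
    refine h.exists_subst_caseB hl (u := v) ?_
    rw [← hσ']
    exact eq_cons_tail σ h.get_zero
  · exact h.exists_subst_caseA hσ

/-- Admissibility is inherited by the preimage under a block substitution. -/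
theorem Adm.of_subst {ρ : Rule} {x : Stream' ℕ} (hx : Binary x) (h0 : x.get 0 = 0)
    (h : Adm (subst ρ x)) : Adm x where
  binary := hx
  get_zero := h0
  lower j := by
    obtain ⟨k, -, hk⟩ := exists_drop_subst ρ x j
    exact LexLE.of_subst hx (hx.drop j) ρ fun M => hk ▸ h.lower k M
  upper j := by
    obtain ⟨k, -, hk⟩ := exists_drop_subst ρ x j
    rcases Nat.eq_zero_or_pos ((x.drop j).get 0) with hj | hj
    · intro N
      rw [eq_cons_tail _ hj]
      exact lexLE_cons_of_lt N Nat.zero_lt_one _ _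
    · refine LexLE.of_subst (hx.drop j) hx.top ρ ?_
      rcases ρ with ⟨l, hl⟩ | ⟨l, hl⟩
      · obtain ⟨i, rfl⟩ : ∃ i, j = i + 1 := by
          refine Nat.exists_eq_succ_of_ne_zero ?_
          rintro rfl
          rw [Stream'.drop_zero] at hj
          omega
        obtain ⟨k, hk⟩ := exists_drop_subst_caseA l hl x i
        have := h.upper k
        rw [hk, top_subst_caseA l hl h0] at this
        exact lexLE_tail this
      · obtain ⟨u, hu⟩ := exists_subst_eq_cons (Rule.caseB l hl) (x.drop j)
        intro M
        cases M with
        | zero => trivial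
        | succ M =>
          have := h.upper (k + 1) M
          rw [← Stream'.drop_drop, hk, hu] at this
          rw [hu, ← top_subst_caseB l hl h0, lexLE_cons_self]
          exact this

theorem EventuallyPeriodic.subst {x : Stream' ℕ} (h : EventuallyPeriodic x) (ρ : Rule) :
    EventuallyPeriodic (subst ρ x) := by
  obtain ⟨N, p, hp, hN⟩ := (eventuallyPeriodic_iff x).1 h
  obtain ⟨k, -, hk⟩ := exists_drop_subst ρ x N
  obtain ⟨k', hk', h'⟩ := exists_drop_subst ρ (x.drop N) p
  refine (eventuallyPeriodic_iff _).2 ⟨k, k', hp.trans_le hk', ?_⟩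
  rw [← Stream'.drop_drop, hk, h', Stream'.drop_drop, hN]

/-- Admissible sequences can be desubstituted forever. -/
theorem Adm.gen {σ : Stream' ℕ} (h : Adm σ) (hp : ¬ EventuallyPeriodic σ) : Gen σ := by
  have step : ∀ s : {σ : Stream' ℕ // Adm σ ∧ ¬ EventuallyPeriodic σ},
      ∃ (ρ : Rule) (t : {σ : Stream' ℕ // Adm σ ∧ ¬ EventuallyPeriodic σ}),
        s.1 = subst ρ t.1 := by
    rintro ⟨σ, h, hp⟩
    obtain ⟨ρ, x, hx, h0, rfl⟩ := h.exists_eq_subst hp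
    exact ⟨ρ, ⟨x, h.of_subst hx h0, fun h1 => hp (h1.subst ρ)⟩, rfl⟩
  choose ρ nx hnx using step
  set s : ℕ → {σ : Stream' ℕ // Adm σ ∧ ¬ EventuallyPeriodic σ} :=
    fun n => nx^[n] ⟨σ, h, hp⟩ with hs
  have hs1 : ∀ n, s (n + 1) = nx (s n) := fun n => Function.iterate_succ_apply' nx n _
  have key : ∀ n i, ∃ u, (s i).1 = (blocks 0 (fun j => ρ (s (j + i))) n).1 ++ₛ u := by
    intro n
    induction n with
    | zero => exact fun i => ⟨_, eq_cons_tail _ (s i).2.1.get_zero⟩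
    | succ n ih =>
      intro i
      obtain ⟨u, hu⟩ := ih (i + 1)
      refine ⟨subst (ρ (s i)) u, ?_⟩
      rw [blocks_succ, hnx (s i), ← hs1, hu, subst_append]
      simp only [Prod.map_fst, Nat.zero_add, add_assoc, add_comm 1]
  exact ⟨fun j => ρ (s j), (isGenerated_iff _ _ _).2 fun n => key n 0⟩

/-! ### Expansions of real numbers -/

/-- The numbers `x 0, x 1, …` and the digits `n 0, n 1, …` satisfy `x i = 1 / (n i - x (i + 1))`,
so that `x i = -(0, n i, n (i + 1), …)`. All the `x i` lie in `(0, 1)`, and in `(0, 1/2]` except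
possibly for `x 0`. -/
structure IsExpansion (x : ℕ → ℝ) (n : Stream' ℕ) : Prop where
  pos : ∀ i, 0 < x i
  lt_one : ∀ i, x i < 1
  le_half : ∀ i, x (i + 1) ≤ 1 / 2
  step : ∀ i, 1 / x i = n.get i - x (i + 1)

theorem IsExpansion.tail {x : ℕ → ℝ} {n : Stream' ℕ} (h : IsExpansion x n) :
    IsExpansion (fun i => x (i + 1)) n.tail :=
  ⟨fun _ => h.pos _, fun _ => h.lt_one _, fun _ => h.le_half _, fun _ => h.step _⟩

theorem IsExpansion.drop {x : ℕ → ℝ} {n : Stream' ℕ} (h : IsExpansion x n) (k : ℕ) :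
    IsExpansion (fun i => x (i + k)) (n.drop k) :=
  ⟨fun i => h.pos _, fun i => h.lt_one _,
    fun i => by have := h.le_half (i + k); rwa [add_right_comm] at this,
    fun i => by
      have := h.step (i + k)
      rw [Stream'.get_drop, this, add_comm k i, add_right_comm]⟩

/-- Smaller numbers have larger digits. -/
theorem IsExpansion.lexLE {x y : ℕ → ℝ} {n k : Stream' ℕ} (hx : IsExpansion x n)
    (hy : IsExpansion y k) (h : x 0 ≤ y 0) (N : ℕ) : LexLE N k n := by
  induction N generalizing x y n k with
  | zero => trivial
  | succ N ih =>
    have h1 := one_div_le_one_div_of_le (hx.pos 0) h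
    rw [hx.step, hy.step] at h1
    have h2 := hx.pos (0 + 1)
    have h3 := hy.lt_one (0 + 1)
    have h4 : k.get 0 < n.get 0 + 1 := by
      have : (k.get 0 : ℝ) < n.get 0 + 1 := by linarith
      exact_mod_cast this
    rcases (Nat.lt_succ_iff.1 h4).lt_or_eq with h5 | h5
    · exact Or.inl h5
    · refine Or.inr ⟨h5, ih hx.tail hy.tail ?_⟩
      rw [h5] at h1
      simp only [Nat.zero_add] at h1 ⊢
      linarith

theorem sub_le_of_one_div_le {x y ε : ℝ} (hx : 0 < x) (hy : 0 < y) (hx' : x ≤ 1 / 2)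
    (hy' : y ≤ 1 / 2) (hε : 0 ≤ ε) (h : 1 / y ≤ 1 / x + ε) : x ≤ y + ε / 4 := by
  have h1 : x - y = x * y * (1 / y - 1 / x) := by field_simp
  have h2 : x * y ≤ 1 / 4 := by nlinarith
  have h3 : x * y * (1 / y - 1 / x) ≤ x * y * ε :=
    mul_le_mul_of_nonneg_left (by linarith) (by positivity)
  nlinarith

/-- Agreement of `N` digits forces the numbers to be close: each step contracts by `1/4`. -/
theorem IsExpansion.le_add_of_lexLE {x y : ℕ → ℝ} {n k : Stream' ℕ} (hx : IsExpansion x n)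
    (hy : IsExpansion y k) (hx0 : x 0 ≤ 1 / 2) (hy0 : y 0 ≤ 1 / 2) {N : ℕ} (h : LexLE N k n) :
    x 0 ≤ y 0 + (1 / 4) ^ N := by
  induction N generalizing x y n k with
  | zero => have := hy.pos 0; norm_num; linarith
  | succ N ih =>
    have hε : (0 : ℝ) ≤ (1 / 4) ^ N := by positivity
    rw [pow_succ, mul_one_div]
    refine sub_le_of_one_div_le (hx.pos 0) (hy.pos 0) hx0 hy0 hε ?_
    rw [hx.step, hy.step]
    rcases h with h | ⟨h, h'⟩
    · have h1 : (k.get 0 : ℝ) + 1 ≤ n.get 0 := by exact_mod_cast h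
      have := hx.lt_one (0 + 1)
      have := hy.pos (0 + 1)
      linarith
    · have h1 := ih hx.tail hy.tail (hx.le_half 0) (hy.le_half 0) h'
      rw [h]
      simp only [Nat.zero_add] at h1 ⊢
      linarith

theorem le_of_forall_le_add_pow {x y : ℝ} (h : ∀ N : ℕ, x ≤ y + (1 / 4) ^ N) : x ≤ y := by
  have h1 : Tendsto (fun N : ℕ => y + (1 / 4 : ℝ) ^ N) atTop (𝓝 (y + 0)) :=
    tendsto_const_nhds.add (tendsto_pow_atTop_nhds_zero_of_lt_one (by norm_num) (by norm_num))
  rw [add_zero] at h1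
  exact ge_of_tendsto' h1 h

theorem IsExpansion.eq_succ {x y : ℕ → ℝ} {n : Stream' ℕ} (hx : IsExpansion x n)
    (hy : IsExpansion y n) (i : ℕ) : x (i + 1) = y (i + 1) := by
  have hx1 := hx.tail.drop i
  have hy1 := hy.tail.drop i
  have hx2 := hx.le_half i
  have hy2 := hy.le_half i
  have h1 := le_of_forall_le_add_pow fun N =>
    hx1.le_add_of_lexLE hy1 (by simpa using hx2) (by simpa using hy2) (LexLE.refl N _)
  have h2 := le_of_forall_le_add_pow fun N =>
    hy1.le_add_of_lexLE hx1 (by simpa using hy2) (by simpa using hx2) (LexLE.refl N _)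
  simpa using le_antisymm h1 h2

theorem IsExpansion.eq {x y : ℕ → ℝ} {n : Stream' ℕ} (hx : IsExpansion x n)
    (hy : IsExpansion y n) : x = y := by
  funext i
  cases i with
  | zero =>
    have h := hx.step 0
    rw [hx.eq_succ hy 0, ← hy.step 0] at h
    simpa using h
  | succ i => exact hx.eq_succ hy i

/-- A number has only one expansion. -/
theorem IsExpansion.digits_eq {x y : ℕ → ℝ} {n k : Stream' ℕ} (hx : IsExpansion x n)
    (hy : IsExpansion y k) (h : x 0 = y 0) : n = k :=
  LexLE.antisymm (hy.lexLE hx h.ge) (hx.lexLE hy h.le)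

theorem lexLE_map_add {N m : ℕ} {x y : Stream' ℕ} :
    LexLE N (x.map (· + m)) (y.map (· + m)) ↔ LexLE N x y := by
  induction N generalizing x y with
  | zero => exact Iff.rfl
  | succ N ih =>
    simp only [LexLE, Stream'.get_map, Stream'.tail_map, ih]
    simp

theorem eventuallyPeriodic_map_add {m : ℕ} {x : Stream' ℕ} :
    EventuallyPeriodic (x.map (· + m)) ↔ EventuallyPeriodic x := by
  refine exists_congr fun N => exists_congr fun p => and_congr_right fun _ =>
    forall_congr' fun i => imp_congr_right fun _ => ?_
  exact add_left_inj m

/-- Periodic tails of the digits belong to equal numbers. -/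
theorem IsExpansion.finite_range {x : ℕ → ℝ} {n : Stream' ℕ} (h : IsExpansion x n)
    (hp : EventuallyPeriodic n) : (Set.range x).Finite := by
  obtain ⟨M, p, hp, hMp⟩ := (eventuallyPeriodic_iff n).1 hp
  refine ((Finset.range (M + p)).finite_toSet.image x).subset ?_
  rintro _ ⟨i, rfl⟩
  have h1 := h.drop (M + p)
  rw [hMp] at h1
  have h2 := h1.eq (h.drop M)
  induction i using Nat.strong_induction_on with
  | _ i ih =>
    rcases Nat.lt_or_ge i (M + p) with hi | hi
    · exact ⟨i, by simpa using hi, rfl⟩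
    · obtain ⟨j, rfl⟩ := Nat.exists_eq_add_of_le' hi
      have h3 : x (j + (M + p)) = x (j + M) := congrFun h2 j
      rw [h3]
      exact ih (j + M) (by omega)

/-- The expansions that come from orbits without the cycle property have admissible digits: if `x
i` stays between the ends of the interval `[x 0 / (1 + x 0), x 0]` and takes infinitely many
values, then the digits are `m` and `m + 1`, and they are generated by block substitutions. -/
theorem IsExpansion.exists_gen {x : ℕ → ℝ} {n : Stream' ℕ} (h : IsExpansion x n)
    (h1 : ∀ i, x i ≤ x 0) (h2 : ∀ i, 1 / x i ≤ 1 / x 0 + 1) (hinf : (Set.range x).Infinite) :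
    ∃ σ, Gen σ ∧ n = σ.map (· + n.get 0) := by
  have hlow : ∀ k N, LexLE N n (n.drop k) := fun k N =>
    (h.drop k).lexLE h (by simpa using h1 k) N
  have hge : ∀ i, n.get 0 ≤ n.get i := by
    intro i
    have := get_zero_le_of_lexLE (hlow i)
    simpa [Stream'.get_drop] using this
  have hle : ∀ i, n.get i ≤ n.get 0 + 1 := by
    intro i
    have h3 := h2 i
    rw [h.step, h.step] at h3
    have h4 := h.lt_one (i + 1)
    have h5 := h.pos (0 + 1)
    have : (n.get i : ℝ) < (n.get 0 + 1 : ℕ) + 1 := by push_cast; linarith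
    have : n.get i < n.get 0 + 1 + 1 := by exact_mod_cast this
    omega
  set σ : Stream' ℕ := fun i => n.get i - n.get 0 with hσ
  have hn : n = σ.map (· + n.get 0) := by
    ext i
    rw [Stream'.get_map]
    exact (Nat.sub_add_cancel (hge i)).symm
  refine ⟨σ, Adm.gen ⟨?_, Nat.sub_self _, ?_, ?_⟩ ?_, hn⟩
  · intro i
    have := hle i
    change n.get i - n.get 0 ≤ 1
    omega
  · intro k N
    have := hlow k N
    rw [hn, Stream'.drop_map] at this
    exact lexLE_map_add.1 this
  · intro k N
    have hk : (σ.drop k).get 0 = n.get k - n.get 0 := by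
      rw [Stream'.get_drop]; rfl
    rcases Nat.eq_zero_or_pos (n.get k - n.get 0) with h3 | h3
    · rw [eq_cons_tail _ (hk.trans h3)]
      exact lexLE_cons_of_lt N Nat.zero_lt_one _ _
    · have h4 : n.get k = n.get 0 + 1 := by have := hle k; omega
      rw [eq_cons_tail _ (hk.trans (show _ = 1 by omega)), top]
      cases N with
      | zero => trivial
      | succ N =>
        rw [lexLE_cons_self, Stream'.tail_drop']
        have h5 := h2 k
        rw [h.step, h.step, h4] at h5
        push_cast at h5
        have h6 := h.tail.lexLE (h.drop (k + 1)) (by simp only [Nat.zero_add] at h5 ⊢; linarith) N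
        rw [hn, Stream'.drop_map, Stream'.tail_map] at h6
        exact lexLE_map_add.1 h6
  · intro hp
    refine hinf (h.finite_range ?_)
    rw [hn]
    exact eventuallyPeriodic_map_add.2 hp

theorem IsExpansion.abs_sub_le {x : ℕ → ℝ} {m : ℕ} {σ : Stream' ℕ}
    (h : IsExpansion x (σ.map (· + m))) {i j N : ℕ}
    (hN : Agree N (σ.drop (i + 1)) (σ.drop (j + 1))) :
    |x (i + 1) - x (j + 1)| ≤ (1 / 4) ^ N := by
  have hi := h.drop (i + 1)
  have hj := h.drop (j + 1)
  rw [Stream'.drop_map] at hi hj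
  have h1 := hi.le_add_of_lexLE hj (by simpa using h.le_half i) (by simpa using h.le_half j)
    (lexLE_map_add.2 hN.2)
  have h2 := hj.le_add_of_lexLE hi (by simpa using h.le_half j) (by simpa using h.le_half i)
    (lexLE_map_add.2 hN.1)
  simp only [Nat.zero_add] at h1 h2
  rw [abs_le]
  constructor <;> linarith

theorem exists_pow_lt {ε : ℝ} (hε : 0 < ε) : ∃ N : ℕ, (1 / 4 : ℝ) ^ N < ε :=
  exists_pow_lt_of_lt_one hε (by norm_num)

/-- For generated digits, the bound `x 0` of the `x i` is sharp. -/
theorem IsExpansion.exists_one_div_lt {x : ℕ → ℝ} {m : ℕ} {σ : Stream' ℕ}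
    (h : IsExpansion x (σ.map (· + m))) (hσ : Gen σ) {δ : ℝ} (hδ : 1 / x 0 < δ) :
    ∃ k, 1 ≤ k ∧ 1 / x k < δ := by
  obtain ⟨N, hN⟩ := exists_pow_lt (sub_pos.2 hδ)
  obtain ⟨k, hk, hkN⟩ := hσ.exists_agree_self (N + 1)
  refine ⟨k, hk, ?_⟩
  have h1 := hkN.1.get_eq hkN.2 0 (by omega)
  rw [Stream'.get_drop, hσ.get_zero, Nat.add_zero] at h1
  rw [eq_cons_tail _ hσ.get_zero, eq_cons_tail ((Stream'.cons 0 σ.tail).drop k) (a := 0)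
    (by rw [← eq_cons_tail _ hσ.get_zero, Stream'.get_drop]; exact h1), agree_cons_self,
    ← eq_cons_tail _ hσ.get_zero, Stream'.tail_drop'] at hkN
  have h2 := abs_le.1 (h.abs_sub_le (i := k) (j := 0) hkN)
  have h3 := h.step 0
  rw [h.step, Stream'.get_map] at *
  rw [h1]
  rw [hσ.get_zero] at h3 hδ hN
  linarith

/-- For generated digits, the bound `1 / x 0 + 1` of the `1 / x i` is sharp. -/
theorem IsExpansion.exists_lt_one_div {x : ℕ → ℝ} {m : ℕ} {σ : Stream' ℕ}
    (h : IsExpansion x (σ.map (· + m))) (hσ : Gen σ) {δ : ℝ} (hδ : δ < 1 / x 0 + 1) :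
    ∃ k, δ < 1 / x k := by
  obtain ⟨N, hN⟩ := exists_pow_lt (sub_pos.2 hδ)
  obtain ⟨k, hkN⟩ := hσ.exists_agree_top N
  refine ⟨k, ?_⟩
  have h1 : (σ.drop k).get 0 = 1 := hkN.1.get_eq hkN.2 0 (by omega)
  rw [eq_cons_tail _ h1, top, agree_cons_self, Stream'.tail_drop'] at hkN
  have h2 := abs_le.1 (h.abs_sub_le (i := k) (j := 0) hkN)
  rw [Stream'.get_drop, Nat.add_zero] at h1
  have h3 := h.step 0
  rw [h.step, Stream'.get_map] at *
  rw [h1]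
  rw [hσ.get_zero] at h3 hδ hN
  push_cast at *
  linarith

/-! ### Values of continued fractions -/

/-- The finite continued fraction `1 / (n 0 - 1 / (n 1 - ⋯ - 1 / n (k - 1)))`. -/
noncomputable def frac : ℕ → Stream' ℕ → ℝ
  | 0, _ => 0
  | k + 1, n => 1 / (n.get 0 - frac k n.tail)

theorem minusFrac_cons (x : ℝ) (l : List ℝ) : minusFrac (x :: l) = x + minusFrac (0 :: l) := by
  cases l with
  | nil => simp [minusFrac]
  | cons y l => simp [minusFrac, sub_eq_add_neg]

theorem neg_minusFrac_eq (k : ℕ) (n : Stream' ℕ) :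
    -minusFrac (0 :: (List.range k).map (fun i => (n.get i : ℝ))) = frac k n := by
  induction k generalizing n with
  | zero => simp [minusFrac, frac]
  | succ k ih =>
    rw [List.range_succ_eq_map, List.map_cons, List.map_map, frac, ← ih n.tail, minusFrac,
      minusFrac_cons]
    simp only [zero_sub, neg_neg, sub_neg_eq_add]
    rfl

theorem isMinusFracValue_iff (n : Stream' ℕ) (b : ℝ) :
    IsMinusFracValue n b ↔ Tendsto (fun k => frac k n) atTop (𝓝 b) := by
  rw [← tendsto_congr fun k => neg_minusFrac_eq k n]
  rfl

theorem frac_mem {n : Stream' ℕ} (hn : ∀ i, 3 ≤ n.get i) (k : ℕ) :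
    0 ≤ frac k n ∧ frac k n ≤ 1 / 2 := by
  induction k generalizing n with
  | zero => norm_num [frac]
  | succ k ih =>
    obtain ⟨h1, h2⟩ := ih (n := n.tail) fun i => hn (i + 1)
    have h3 : (3 : ℝ) ≤ n.get 0 := by exact_mod_cast hn 0
    rw [frac]
    exact ⟨one_div_nonneg.2 (by linarith), one_div_le_one_div_of_le two_pos (by linarith)⟩

theorem abs_one_div_sub_le {m s t ε : ℝ} (hm : 3 ≤ m) (hs : s ≤ 1 / 2) (ht : t ≤ 1 / 2)
    (h : |s - t| ≤ ε) : |1 / (m - s) - 1 / (m - t)| ≤ ε / 4 := by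
  have hε : 0 ≤ ε := (abs_nonneg _).trans h
  have hs' : 0 < m - s := by linarith
  have ht' : 0 < m - t := by linarith
  have h1 : 1 / (m - s) ≤ 1 / 2 := one_div_le_one_div_of_le two_pos (by linarith)
  have h2 : 1 / (m - t) ≤ 1 / 2 := one_div_le_one_div_of_le two_pos (by linarith)
  rw [abs_le] at h ⊢
  have h3 := sub_le_of_one_div_le (x := 1 / (m - s)) (y := 1 / (m - t)) (ε := ε)
    (by positivity) (by positivity) h1 h2 hε (by rw [one_div_one_div, one_div_one_div]; linarith)
  have h4 := sub_le_of_one_div_le (x := 1 / (m - t)) (y := 1 / (m - s)) (ε := ε)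
    (by positivity) (by positivity) h2 h1 hε (by rw [one_div_one_div, one_div_one_div]; linarith)
  constructor <;> linarith

theorem abs_frac_sub_le {n : Stream' ℕ} (hn : ∀ i, 3 ≤ n.get i) (k : ℕ) :
    |frac k n - frac (k + 1) n| ≤ 1 * (1 / 4) ^ k := by
  induction k generalizing n with
  | zero =>
    obtain ⟨h1, h2⟩ := frac_mem hn 1
    have h0 : frac 0 n = 0 := rfl
    rw [h0, abs_le, pow_zero]
    constructor <;> linarith
  | succ k ih =>
    have hn' : ∀ i, 3 ≤ n.tail.get i := fun i => hn (i + 1)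
    have h3 : (3 : ℝ) ≤ n.get 0 := by exact_mod_cast hn 0
    have := abs_one_div_sub_le h3 (frac_mem hn' k).2 (frac_mem hn' (k + 1)).2 (ih hn')
    rw [frac, frac, pow_succ, ← mul_assoc, mul_one_div]
    exact this

theorem exists_isExpansion {n : Stream' ℕ} (hn : ∀ i, 3 ≤ n.get i) :
    ∃ x, IsExpansion x n ∧ x 0 ≤ 1 / 2 ∧ IsMinusFracValue n (x 0) := by
  have hex : ∀ s : Stream' ℕ, (∀ i, 3 ≤ s.get i) →
      ∃ L, Tendsto (fun k => frac k s) atTop (𝓝 L) := fun s hs =>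
    cauchySeq_tendsto_of_complete
      (cauchySeq_of_le_geometric (1 / 4) 1 (by norm_num) (abs_frac_sub_le hs))
  have hd : ∀ i j, 3 ≤ (n.drop i).get j := fun i j => by rw [Stream'.get_drop]; exact hn _
  choose x hx using fun i => hex (n.drop i) (hd i)
  have hmem : ∀ i, 0 ≤ x i ∧ x i ≤ 1 / 2 := fun i =>
    ⟨ge_of_tendsto' (hx i) fun k => (frac_mem (hd i) k).1,
      le_of_tendsto' (hx i) fun k => (frac_mem (hd i) k).2⟩
  have h3 : ∀ i, (3 : ℝ) ≤ n.get i := fun i => by exact_mod_cast hn i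
  have hstep : ∀ i, x i = 1 / (n.get i - x (i + 1)) := by
    intro i
    have h1 : Tendsto (fun k => frac (k + 1) (n.drop i)) atTop (𝓝 (x i)) :=
      (tendsto_add_atTop_iff_nat 1).2 (hx i)
    have h2 : Tendsto (fun k => frac (k + 1) (n.drop i)) atTop
        (𝓝 (1 / (n.get i - x (i + 1)))) := by
      have h4 := (tendsto_const_nhds (x := (n.get i : ℝ))).sub (hx (i + 1))
      have h5 := h3 i
      have h6 := (hmem (i + 1)).2
      have h7 := (tendsto_const_nhds (x := (1 : ℝ))).div h4
        (by linarith : (n.get i : ℝ) - x (i + 1) ≠ 0)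
      refine h7.congr fun k => ?_
      rw [frac, Stream'.get_drop, Stream'.tail_drop']
      rfl
    exact tendsto_nhds_unique h1 h2
  refine ⟨x, ⟨fun i => ?_, fun i => ?_, fun i => (hmem _).2, fun i => ?_⟩, (hmem 0).2,
    (isMinusFracValue_iff _ _).2 (hx 0)⟩
  · rw [hstep]
    have h5 := h3 i
    have h6 := (hmem (i + 1)).2
    exact one_div_pos.2 (by linarith)
  · linarith [(hmem i).2]
  · rw [hstep i, one_div_one_div]

theorem IsExpansion.three_le {x : ℕ → ℝ} {n : Stream' ℕ} (h : IsExpansion x n)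
    (h0 : x 0 ≤ 1 / 2) (i : ℕ) : 3 ≤ n.get i := by
  have h1 : x i ≤ 1 / 2 := by
    cases i with
    | zero => exact h0
    | succ i => exact h.le_half i
  have h2 := one_div_le_one_div_of_le (h.pos i) h1
  rw [h.step, one_div_one_div] at h2
  have h3 := h.pos (i + 1)
  have : ((2 : ℕ) : ℝ) < n.get i := by push_cast; linarith
  exact_mod_cast this

theorem IsExpansion.isMinusFracValue {x : ℕ → ℝ} {n : Stream' ℕ} (h : IsExpansion x n)
    (h0 : x 0 ≤ 1 / 2) : IsMinusFracValue n (x 0) := by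
  obtain ⟨y, hy, -, hy'⟩ := exists_isExpansion (h.three_le h0)
  rwa [h.eq hy]

/-! ### Orbits of the discontinuity points -/

theorem T_coe (x : ℝ) : T (x : OnePoint ℝ) = ((x + 1 : ℝ) : OnePoint ℝ) := rfl

theorem T_inv_coe (x : ℝ) : T⁻¹ (x : OnePoint ℝ) = ((x - 1 : ℝ) : OnePoint ℝ) := rfl

theorem S_coe {x : ℝ} (hx : x ≠ 0) : S (x : OnePoint ℝ) = ((-1 / x : ℝ) : OnePoint ℝ) :=
  if_neg hx

theorem rhoUpper_coe (a b x : ℝ) :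
    rhoUpper a b (x : OnePoint ℝ) = if x < a then T else if x < b then S else T⁻¹ := rfl

theorem rhoLower_coe (a b x : ℝ) :
    rhoLower a b (x : OnePoint ℝ) = if x ≤ a then T else if x ≤ b then S else T⁻¹ := rfl

namespace SplitPoint

variable {s : SplitPoint}

theorem up_succ (s : SplitPoint) (m : ℕ) :
    s.up (m + 1) = rhoUpper s.a s.b (s.up m) (s.up m) := rfl

theorem lo_succ (s : SplitPoint) (k : ℕ) :
    s.lo (k + 1) = rhoLower s.a s.b (s.lo k) (s.lo k) := rfl

/-- The upper orbit visits the real number `y`. -/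
def UpAt (s : SplitPoint) (y : ℝ) : Prop := ∃ m, s.up m = (y : OnePoint ℝ)

/-- The lower orbit visits the real number `y`. -/
def LoAt (s : SplitPoint) (y : ℝ) : Prop := ∃ k, s.lo k = (y : OnePoint ℝ)

theorem UpAt.hasCycle {y : ℝ} (h : s.UpAt y) (h' : s.LoAt y) : s.HasCycle := by
  obtain ⟨m, hm⟩ := h
  obtain ⟨k, hk⟩ := h'
  exact ⟨m, k, hm.trans hk.symm⟩

theorem UpAt.S {y : ℝ} (h : s.UpAt y) (h1 : s.a ≤ y) (h2 : y < s.b) (h0 : y ≠ 0) :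
    s.UpAt (-1 / y) := by
  obtain ⟨m, hm⟩ := h
  refine ⟨m + 1, ?_⟩
  rw [up_succ, hm, rhoUpper_coe, if_neg h1.not_gt, if_pos h2, S_coe h0]

theorem UpAt.sub_one {y : ℝ} (h : s.UpAt y) (h1 : s.a ≤ y) (h2 : s.b ≤ y) : s.UpAt (y - 1) := by
  obtain ⟨m, hm⟩ := h
  refine ⟨m + 1, ?_⟩
  rw [up_succ, hm, rhoUpper_coe, if_neg h1.not_gt, if_neg h2.not_gt, T_inv_coe]

theorem LoAt.S {y : ℝ} (h : s.LoAt y) (h1 : s.a < y) (h2 : y ≤ s.b) (h0 : y ≠ 0) :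
    s.LoAt (-1 / y) := by
  obtain ⟨m, hm⟩ := h
  refine ⟨m + 1, ?_⟩
  rw [lo_succ, hm, rhoLower_coe, if_neg h1.not_ge, if_pos h2, S_coe h0]

theorem LoAt.add_one {y : ℝ} (h : s.LoAt y) (h1 : y ≤ s.a) : s.LoAt (y + 1) := by
  obtain ⟨m, hm⟩ := h
  refine ⟨m + 1, ?_⟩
  rw [lo_succ, hm, rhoLower_coe, if_pos h1, T_coe]

/-- The finiteness condition at one discontinuity point: the sides of a cycle are always finite, so
that only orbits without the cycle property have to be considered. -/
def Tame (s : SplitPoint) : Prop :=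
  s.HasCycle ∨ (Set.range s.lo).Finite ∧ (Set.range s.up).Finite

theorem finite_loSide (s : SplitPoint) : s.loSide.Finite := by
  refine ((Set.finite_lt_nat s.loLength).image s.lo).subset ?_
  rintro y ⟨k, hk, rfl⟩
  exact ⟨k, hk, rfl⟩

theorem finite_upSide (s : SplitPoint) : s.upSide.Finite := by
  refine ((Set.finite_lt_nat s.upLength).image s.up).subset ?_
  rintro y ⟨k, hk, rfl⟩
  exact ⟨k, hk, rfl⟩

theorem tame_iff (s : SplitPoint) : s.Tame ↔ s.truncLo.Finite ∧ s.truncUp.Finite := by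
  unfold Tame truncLo truncUp
  by_cases h : s.HasCycle
  · by_cases h' : s.HasStrongCycle
    · simp [h, h', s.finite_loSide, s.finite_upSide]
    · simp [h, h', s.finite_loSide, s.finite_upSide]
  · simp [h]

end SplitPoint

theorem finitenessCondition_iff (a b : ℝ) :
    FinitenessCondition a b ↔ (splitA a b).Tame ∧ (splitB a b).Tame := by
  rw [SplitPoint.tame_iff, SplitPoint.tame_iff, FinitenessCondition]
  tauto

/-! ### The reflection `x ↦ -x` -/

/-- The reflection `x ↦ -x` of the extended real line. -/
def reflect : OnePoint ℝ → OnePoint ℝ := OnePoint.map Neg.neg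

theorem reflect_coe (x : ℝ) : reflect (x : OnePoint ℝ) = ((-x : ℝ) : OnePoint ℝ) := rfl

theorem reflect_reflect (x : OnePoint ℝ) : reflect (reflect x) = x := by
  induction x using OnePoint.rec with
  | infty => rfl
  | coe x => simp [reflect_coe]

theorem reflect_T (x : OnePoint ℝ) : reflect (T x) = T⁻¹ (reflect x) := by
  induction x using OnePoint.rec with
  | infty => rfl
  | coe x => rw [T_coe, reflect_coe, reflect_coe, T_inv_coe]; congr 1; ring

theorem reflect_T_inv (x : OnePoint ℝ) : reflect (T⁻¹ x) = T (reflect x) := by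
  induction x using OnePoint.rec with
  | infty => rfl
  | coe x => rw [T_inv_coe, reflect_coe, reflect_coe, T_coe]; congr 1; ring

theorem reflect_S (x : OnePoint ℝ) : reflect (S x) = S (reflect x) := by
  induction x using OnePoint.rec with
  | infty =>
    change ((-0 : ℝ) : OnePoint ℝ) = ((0 : ℝ) : OnePoint ℝ)
    rw [neg_zero]
  | coe x =>
    rw [reflect_coe]
    by_cases hx : x = 0
    · subst hx
      rw [neg_zero]
      change reflect (if (0 : ℝ) = 0 then OnePoint.infty else _) =
        (if (0 : ℝ) = 0 then OnePoint.infty else _)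
      rw [if_pos rfl]
      rfl
    · rw [S_coe hx, S_coe (neg_ne_zero.2 hx), reflect_coe]
      congr 1
      field_simp

theorem reflect_rhoUpper {a b : ℝ} (hab : a ≤ b) (x : OnePoint ℝ) :
    reflect (rhoUpper a b x x) = rhoLower (-b) (-a) (reflect x) (reflect x) := by
  induction x using OnePoint.rec with
  | infty => rfl
  | coe x =>
    rw [reflect_coe, rhoUpper_coe, rhoLower_coe, ← reflect_coe]
    simp only [neg_le_neg_iff]
    rcases lt_or_ge x a with h1 | h1
    · rw [if_pos h1, if_neg (h1.trans_le hab).not_ge, if_neg h1.not_ge, reflect_T]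
    · rcases lt_or_ge x b with h2 | h2
      · rw [if_neg h1.not_gt, if_pos h2, if_neg h2.not_ge, if_pos h1, reflect_S]
      · rw [if_neg h1.not_gt, if_neg h2.not_gt, if_pos h2, reflect_T_inv]

theorem reflect_orbit {a b : ℝ} (hab : a ≤ b) (x : OnePoint ℝ) (n : ℕ) :
    reflect (orbit (rhoUpper a b) x n) = orbit (rhoLower (-b) (-a)) (reflect x) n := by
  induction n with
  | zero => rfl
  | succ n ih => rw [orbit, orbit, reflect_rhoUpper hab, ih]

theorem reflect_upA {a b : ℝ} (hab : a ≤ b) (n : ℕ) :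
    reflect ((splitA a b).up n) = (splitB (-b) (-a)).lo n := by
  refine (reflect_orbit hab _ n).trans ?_
  change orbit _ (reflect (S _)) n = _
  rw [reflect_S]; rfl

theorem reflect_upB {a b : ℝ} (hab : a ≤ b) (n : ℕ) :
    reflect ((splitB a b).up n) = (splitA (-b) (-a)).lo n := by
  refine (reflect_orbit hab _ n).trans ?_
  change orbit _ (reflect (T⁻¹ _)) n = _
  rw [reflect_T_inv]; rfl

theorem tame_of_reflect {s t : SplitPoint} (h : ∀ n, reflect (s.up n) = t.lo n)
    (h' : ∀ n, reflect (t.up n) = s.lo n) (hs : s.Tame) : t.Tame := by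
  have h'' : ∀ n, reflect (s.lo n) = t.up n := fun n => by rw [← h', reflect_reflect]
  rcases hs with ⟨m, k, hmk⟩ | ⟨h1, h2⟩
  · exact Or.inl ⟨k, m, by rw [← h, ← h'', hmk]⟩
  · refine Or.inr ⟨(h2.image reflect).subset ?_, (h1.image reflect).subset ?_⟩
    · rintro _ ⟨n, rfl⟩
      exact ⟨s.up n, ⟨n, rfl⟩, h n⟩
    · rintro _ ⟨n, rfl⟩
      exact ⟨s.lo n, ⟨n, rfl⟩, h'' n⟩

theorem finitenessCondition_reflect {a b : ℝ} (hab : a ≤ b) (h : FinitenessCondition a b) :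
    FinitenessCondition (-b) (-a) := by
  rw [finitenessCondition_iff] at h ⊢
  have hA := reflect_upA (neg_le_neg hab)
  have hB := reflect_upB (neg_le_neg hab)
  rw [neg_neg, neg_neg] at hA hB
  exact ⟨tame_of_reflect (reflect_upB hab) hA h.2, tame_of_reflect (reflect_upA hab) hB h.1⟩

theorem finitenessCondition_reflect_iff {a b : ℝ} (hab : a ≤ b) :
    FinitenessCondition (-b) (-a) ↔ FinitenessCondition a b :=
  ⟨fun h => by simpa using finitenessCondition_reflect (neg_le_neg hab) h,
    finitenessCondition_reflect hab⟩

theorem reflect_mem_paramSet {a b : ℝ} (h : (a, b) ∈ paramSet) : (-b, -a) ∈ paramSet := by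
  obtain ⟨h1, h2, h3, h4⟩ := h
  simp only at h1 h2 h3 h4
  refine ⟨?_, ?_, ?_, ?_⟩ <;> simp only <;> nlinarith

theorem reflect_mem_exceptionalSet {a b : ℝ} (h : (a, b) ∈ exceptionalSet) :
    (-b, -a) ∈ exceptionalSet :=
  ⟨reflect_mem_paramSet h.1, fun h' =>
    h.2 ((finitenessCondition_reflect_iff (h.1.1.trans h.1.2.1)).1 h')⟩

theorem reflect_mem_exceptionalSet_iff (a b : ℝ) :
    (a, b) ∈ exceptionalSet ↔ (-b, -a) ∈ exceptionalSet :=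
  ⟨reflect_mem_exceptionalSet, fun h => by simpa using reflect_mem_exceptionalSet h⟩

/-! ### The structure of the orbits without the cycle property -/

namespace SplitPoint

variable {s : SplitPoint}

/-- After parallel passages of `S` and of a translation, the upper and the lower orbit are at points
`1/t - 1` and `1 - t`; both then move on to the points belonging to `t - 1`, until the lower orbit
reaches a point `1 - t > 0`, unless the orbits meet before. -/
theorem descent (hb : 0 < s.b) (hab : s.a ≤ s.b - 1) (ha : s.a < 0)
    (hcyc : ¬ s.HasCycle) {t : ℝ} (ht : -s.a ≤ t) (htb : t ≤ 1 / s.b) (hup : s.UpAt (1 / t - 1))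
    (hlo : s.LoAt (1 - t)) :
    ∃ k : ℕ, t - k < 1 ∧ -s.a ≤ t - k ∧ s.UpAt (1 / (t - k) - 1) ∧ s.LoAt (1 - (t - k)) := by
  obtain ⟨N, hN⟩ := exists_nat_gt t
  induction N generalizing t with
  | zero => norm_num at hN; linarith
  | succ N ih =>
    rcases lt_trichotomy t 1 with h1 | h1 | h1
    · exact ⟨0, by simpa using h1, by simpa using ht, by simpa using hup, by simpa using hlo⟩
    · subst h1
      exact absurd (hup.hasCycle (by simpa using hlo)) hcyc
    · have ht0 : 0 < t := by linarith
      have ht1 : 0 < t - 1 := by linarith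
      have hbt : s.b ≤ 1 / t := by
        rw [le_div_iff₀ ht0]; rw [le_div_iff₀ hb] at htb; linarith
      have hbt1 : s.b ≤ 1 / (t - 1) := hbt.trans (one_div_le_one_div_of_le ht1 (by linarith))
      have h1t : 1 / t < 1 := by rw [div_lt_one ht0]; exact h1
      have hne : 1 / t - 1 ≠ 0 := by linarith
      have h2 := hup.S (by linarith) (by linarith) hne
      have h3 : -1 / (1 / t - 1) = 1 / (t - 1) + 1 := by
        have : t - 1 ≠ 0 := ht1.ne'
        have : 1 - t ≠ 0 := by linarith
        field_simp
        ring
      rw [h3] at h2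
      -- the upper orbit reaches `1/(t - 1)`, and so does the lower one if `S` applies to it
      have h4 := h2.sub_one (by linarith) (by linarith)
      rw [add_sub_cancel_right] at h4
      rcases lt_or_ge s.a (1 - t) with h5 | h5
      · have h6 := hlo.S h5 (by linarith) (by linarith)
        rw [show -1 / (1 - t) = 1 / (t - 1) by rw [← neg_sub t 1, neg_div_neg_eq]] at h6
        exact absurd (h4.hasCycle h6) hcyc
      · have h6 := hlo.add_one h5
        have h7 := h4.sub_one (by linarith) hbt1
        obtain ⟨k, hk⟩ := ih (t := t - 1) (by linarith) (by linarith) h7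
          (by rwa [show 1 - t + 1 = 1 - (t - 1) by ring] at h6) (by push_cast at hN; linarith)
        refine ⟨k + 1, ?_⟩
        push_cast
        rwa [show t - (k + 1 : ℝ) = t - 1 - k by ring]

/-- The situation at the end of the descent, with `x = 1 - t`: the lower orbit visits the point
`x ∈ (0, a + 1]`, and the upper orbit the point `x / (1 - x)`. -/
def Return (s : SplitPoint) (x : ℝ) : Prop :=
  0 < x ∧ x ≤ s.a + 1 ∧ s.LoAt x ∧ s.UpAt (x / (1 - x))

theorem exists_return (hb : 0 < s.b) (hab : s.a ≤ s.b - 1) (ha : s.a < 0)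
    (hcyc : ¬ s.HasCycle) {t : ℝ} (ht : -s.a ≤ t) (htb : t ≤ 1 / s.b) (hup : s.UpAt (1 / t - 1))
    (hlo : s.LoAt (1 - t)) : ∃ (k : ℕ) (x : ℝ), t = k + 1 - x ∧ s.Return x := by
  obtain ⟨k, h1, h2, h3, h4⟩ := descent hb hab ha hcyc ht htb hup hlo
  refine ⟨k, 1 - (t - k), by ring, by linarith, by linarith, h4, ?_⟩
  rw [sub_sub_cancel, sub_div, div_self (by linarith)]
  exact h3

/-- One turn of the orbits: either they meet, which happens if `x / (1 - x) < b`, or the lower orbit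
returns to `(0, a + 1]` at a point `n - 1 / x`. -/
theorem Return.exists_next {x : ℝ} (hb : 0 < s.b) (hab : s.a ≤ s.b - 1) (hba : s.b ≤ -s.a)
    (ha1 : -1 < s.a) (hcyc : ¬ s.HasCycle) (h : s.Return x) :
    1 / x ≤ 1 / s.b + 1 ∧ ∃ (n : ℕ) (y : ℝ), 1 / x = n - y ∧ s.Return y := by
  obtain ⟨hx, hxa, hlo, hup⟩ := h
  have hx1 : x ≤ 1 / 2 := by linarith
  have h1 := hlo.S (by linarith) (by linarith) hx.ne'
  have h2x : 2 ≤ 1 / x := by rw [le_div_iff₀ hx]; linarith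
  have h2 := h1.add_one (by rw [neg_div]; linarith)
  have hne : 1 - x ≠ 0 := by linarith
  have hlt : s.b ≤ x / (1 - x) := by
    -- otherwise `S` applies to the upper orbit, and `S (x / (1 - x)) = T (S x)`
    by_contra! hlt
    have hp : 0 < x / (1 - x) := div_pos hx (by linarith)
    have h3 := hup.S (by linarith) hlt hp.ne'
    refine hcyc (h3.hasCycle ?_)
    convert h2 using 1
    field_simp
    ring
  have hxb : 1 / x ≤ 1 / s.b + 1 := by
    have := one_div_le_one_div_of_le hb hlt
    rw [one_div_div, sub_div, div_self hx.ne'] at this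
    linarith
  refine ⟨hxb, ?_⟩
  have h4 := hup.sub_one (by linarith) hlt
  have h5 := h2.add_one (by rw [neg_div]; linarith)
  have hne' : 1 / x - 1 ≠ 0 := by linarith
  obtain ⟨k, y, hk, hy⟩ := exists_return hb hab (by linarith) hcyc
    (t := 1 / x - 1) (by linarith) (by linarith)
    (by
      have : 1 / (1 / x - 1) = x / (1 - x) := by field_simp
      rwa [this])
    (by
      have : 1 - (1 / x - 1) = -1 / x + 1 + 1 := by ring
      rwa [this])
  exact ⟨k + 2, y, by push_cast; linarith, hy⟩

/-- Without the cycle property, the lower orbit returns to `(0, a + 1]` forever. -/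
theorem Return.exists_seq {x₀ : ℝ} (hb : 0 < s.b) (hab : s.a ≤ s.b - 1) (hba : s.b ≤ -s.a)
    (ha1 : -1 < s.a) (hcyc : ¬ s.HasCycle) (h : s.Return x₀) :
    ∃ (x : ℕ → ℝ) (n : Stream' ℕ), x 0 = x₀ ∧ (∀ i, 0 < x i ∧ x i ≤ s.a + 1) ∧
      (∀ i, 1 / x i ≤ 1 / s.b + 1) ∧ ∀ i, 1 / x i = n.get i - x (i + 1) := by
  have step : ∀ y : {y // s.Return y}, ∃ (k : ℕ) (z : {y // s.Return y}), 1 / y.1 = k - z.1 := by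
    rintro ⟨y, hy⟩
    obtain ⟨-, n, z, hz, hz'⟩ := hy.exists_next hb hab hba ha1 hcyc
    exact ⟨n, ⟨z, hz'⟩, hz⟩
  choose d nx hd using step
  set y : ℕ → {y // s.Return y} := fun i => nx^[i] ⟨x₀, h⟩ with hy
  refine ⟨fun i => (y i).1, fun i => d (y i), rfl, fun i => ⟨(y i).2.1, (y i).2.2.1⟩,
    fun i => ((y i).2.exists_next hb hab hba ha1 hcyc).1, fun i => ?_⟩
  have h1 : y (i + 1) = nx (y i) := Function.iterate_succ_apply' nx i _
  change 1 / (y i).1 = (d (y i) : ℝ) - (y (i + 1)).1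
  rw [h1, hd]

end SplitPoint

/-- The points of the upper orbit that belong to the expansion `x`, `n`: those following the point
`x 0 / (1 - x 0)`. -/
def upSet (x : ℕ → ℝ) (n : Stream' ℕ) : Set ℝ :=
  {y | ∃ i k : ℕ, 1 ≤ k ∧ k < n.get i ∧ (y = 1 / (k - x (i + 1)) ∨ y = 1 / (k - x (i + 1)) + 1 ∨
    2 ≤ k ∧ y = 1 / (k - x (i + 1)) - 1)}

/-- The points of the lower orbit that belong to the expansion `x`, `n`: those following, and
including, the point `-1 / x 0 = x 1 - n 0`. -/
def loSet (x : ℕ → ℝ) (n : Stream' ℕ) : Set ℝ :=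
  {y | ∃ i k : ℕ, k ≤ n.get i ∧ y = x (i + 1) - k}

theorem IsExpansion.two_le {x : ℕ → ℝ} {n : Stream' ℕ} (h : IsExpansion x n) (i : ℕ) :
    2 ≤ n.get i := by
  have h1 := one_lt_one_div (h.pos i) (h.lt_one i)
  rw [h.step] at h1
  have h2 := h.pos (i + 1)
  have : ((1 : ℕ) : ℝ) < n.get i := by push_cast; linarith
  exact_mod_cast this

theorem IsExpansion.bounds_of_lt {x : ℕ → ℝ} {n : Stream' ℕ} {b : ℝ} (h : IsExpansion x n)
    (hb : 0 < b) (hxb : ∀ i, 1 / x i ≤ 1 / b + 1) {i k : ℕ} (h1 : 1 ≤ k) (hk : k < n.get i) :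
    0 < k - x (i + 1) ∧ b ≤ 1 / (k - x (i + 1)) ∧ (2 ≤ k → 1 / (k - x (i + 1)) < 1) := by
  have h2 := h.le_half i
  have h3 : (1 : ℝ) ≤ k := by exact_mod_cast h1
  have h4 : (k : ℝ) + 1 ≤ n.get i := by exact_mod_cast hk
  have h5 := hxb i
  rw [h.step] at h5
  refine ⟨by linarith, ?_, fun h6 => ?_⟩
  · rw [le_one_div hb (by linarith)]
    linarith
  · have h7 : (2 : ℝ) ≤ k := by exact_mod_cast h6
    rw [div_lt_one (by linarith)]
    linarith

namespace SplitPoint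

variable {s : SplitPoint}

theorem up_succ_mem {x : ℕ → ℝ} {n : Stream' ℕ} (h : IsExpansion x n) (ha : s.a < 0)
    (hb : 0 < s.b) (hab : s.a ≤ s.b - 1) (hxb : ∀ i, 1 / x i ≤ 1 / s.b + 1)
    {m : ℕ} {y : ℝ} (hy : y ∈ upSet x n) (hm : s.up m = (y : OnePoint ℝ)) :
    ∃ z ∈ upSet x n, s.up (m + 1) = (z : OnePoint ℝ) := by
  obtain ⟨i, k, h1, hk, hy⟩ := hy
  obtain ⟨h2, h3, h4⟩ := h.bounds_of_lt hb hxb h1 hk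
  have hdiv : ∀ z : ℝ, s.b ≤ z → s.up m = (z : OnePoint ℝ) →
      s.up (m + 1) = ((z - 1 : ℝ) : OnePoint ℝ) := by
    intro z hz hm
    rw [up_succ, hm, rhoUpper_coe, if_neg (by linarith), if_neg hz.not_gt, T_inv_coe]
  rcases hy with rfl | rfl | ⟨h5, rfl⟩
  · refine ⟨_, ?_, hdiv _ h3 hm⟩
    -- for `k = 1` the next point is `x (i + 1) / (1 - x (i + 1))`, which starts the next digit
    rcases h1.lt_or_eq with h6 | h6
    · exact ⟨i, k, h1, hk, Or.inr (Or.inr ⟨h6, rfl⟩)⟩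
    · have h7 := h.two_le (i + 1)
      refine ⟨i + 1, n.get (i + 1) - 1, by omega, by omega, Or.inl ?_⟩
      have h8 := h.step (i + 1)
      have h9 := h.pos (i + 1)
      have h10 := h.lt_one (i + 1)
      have h11 : 1 - x (i + 1) ≠ 0 := by linarith
      rw [Nat.cast_sub (by omega), Nat.cast_one, sub_right_comm, ← h8, ← h6, Nat.cast_one]
      have h12 : 1 / x (i + 1) - 1 = (1 - x (i + 1)) / x (i + 1) := by field_simp
      rw [h12]
      field_simp
      ring
  · refine ⟨_, ?_, hdiv _ (by linarith) hm⟩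
    rw [add_sub_cancel_right]
    exact ⟨i, k, h1, hk, Or.inl rfl⟩
  · have h6 := h4 h5
    have h7 : (2 : ℝ) ≤ k := by exact_mod_cast h5
    have h8 := h.le_half i
    have h9 : (1 / (k - x (i + 1)) : ℝ) - 1 ≠ 0 := by linarith
    refine ⟨-1 / (1 / (k - x (i + 1)) - 1), ?_, ?_⟩
    · refine ⟨i, k - 1, by omega, by omega, Or.inr (Or.inl ?_)⟩
      rw [Nat.cast_sub (by omega), Nat.cast_one]
      have h10 : (k - x (i + 1) : ℝ) ≠ 0 := h2.ne'
      have h11 : (k - 1 - x (i + 1) : ℝ) ≠ 0 := by linarith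
      have h12 : (1 - (k - x (i + 1)) : ℝ) ≠ 0 := by linarith
      have h13 : (1 / (k - x (i + 1)) - 1 : ℝ) = (1 - (k - x (i + 1))) / (k - x (i + 1)) := by
        field_simp
      rw [h13]
      field_simp
      ring
    · rw [up_succ, hm, rhoUpper_coe, if_neg (by linarith), if_pos (by linarith), S_coe h9]

theorem up_mem_of_le {x : ℕ → ℝ} {n : Stream' ℕ} (h : IsExpansion x n) (ha : s.a < 0)
    (hb : 0 < s.b) (hab : s.a ≤ s.b - 1) (hxb : ∀ i, 1 / x i ≤ 1 / s.b + 1)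
    {m₀ : ℕ} (hm : s.up m₀ = ((x 0 / (1 - x 0) : ℝ) : OnePoint ℝ)) {m : ℕ} (hle : m₀ ≤ m) :
    ∃ z ∈ upSet x n, s.up m = (z : OnePoint ℝ) := by
  induction m, hle using Nat.le_induction with
  | base =>
    refine ⟨_, ⟨0, n.get 0 - 1, ?_, ?_, Or.inl rfl⟩, ?_⟩
    · have := h.two_le 0; omega
    · have := h.two_le 0; omega
    · have h7 := h.two_le 0
      have h1 := h.pos 0
      have h2 := h.lt_one 0
      have h3 : 1 - x 0 ≠ 0 := by linarith
      rw [hm, Nat.cast_sub (by omega), Nat.cast_one, sub_right_comm, ← h.step 0]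
      congr 1
      have h12 : 1 / x 0 - 1 = (1 - x 0) / x 0 := by field_simp
      rw [h12, one_div_div]
  | succ m _ ih =>
    obtain ⟨y, hy, hm⟩ := ih
    exact up_succ_mem h ha hb hab hxb hy hm

theorem lo_succ_mem {x : ℕ → ℝ} {n : Stream' ℕ} (h : IsExpansion x n) (ha : s.a < 0)
    (hab : s.a ≤ s.b - 1) (hxa : ∀ i, x (i + 1) ≤ s.a + 1) {m : ℕ} {y : ℝ} (hy : y ∈ loSet x n)
    (hm : s.lo m = (y : OnePoint ℝ)) : ∃ z ∈ loSet x n, s.lo (m + 1) = (z : OnePoint ℝ) := by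
  obtain ⟨i, k, hk, rfl⟩ := hy
  have h1 := hxa i
  have h2 := h.pos (i + 1)
  rcases Nat.eq_zero_or_pos k with rfl | h3
  · refine ⟨x (i + 2) - n.get (i + 1), ⟨i + 1, _, le_rfl, rfl⟩, ?_⟩
    rw [Nat.cast_zero, sub_zero] at hm
    rw [lo_succ, hm, rhoLower_coe, if_neg (by linarith), if_pos (by linarith), S_coe h2.ne']
    congr 1
    rw [neg_div, h.step]
    ring
  · refine ⟨x (i + 1) - (k - 1 : ℕ), ⟨i, _, by omega, rfl⟩, ?_⟩
    have h4 : (1 : ℝ) ≤ k := by exact_mod_cast h3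
    rw [lo_succ, hm, rhoLower_coe, if_pos (by linarith), T_coe, Nat.cast_sub h3]
    congr 1
    push_cast
    ring

theorem lo_mem_of_le {x : ℕ → ℝ} {n : Stream' ℕ} (h : IsExpansion x n) (ha : s.a < 0)
    (hab : s.a ≤ s.b - 1) (hxa : ∀ i, x (i + 1) ≤ s.a + 1) {m₀ : ℕ}
    (hm : s.lo m₀ = ((-1 / x 0 : ℝ) : OnePoint ℝ)) {m : ℕ} (hle : m₀ ≤ m) :
    ∃ z ∈ loSet x n, s.lo m = (z : OnePoint ℝ) := by
  induction m, hle using Nat.le_induction with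
  | base =>
    refine ⟨_, ⟨0, n.get 0, le_rfl, rfl⟩, ?_⟩
    rw [hm, neg_div, h.step, neg_sub]
  | succ m _ ih =>
    obtain ⟨y, hy, hm⟩ := ih
    exact lo_succ_mem h ha hab hxa hy hm

end SplitPoint

theorem finite_range_of_le {g : ℕ → OnePoint ℝ} {U : Set ℝ} (hU : U.Finite) {m₀ : ℕ}
    (h : ∀ m, m₀ ≤ m → ∃ z ∈ U, g m = (z : OnePoint ℝ)) : (Set.range g).Finite := by
  refine (((Set.finite_lt_nat m₀).image g).union (hU.image ((↑) : ℝ → OnePoint ℝ))).subset ?_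
  rintro _ ⟨m, rfl⟩
  rcases Nat.lt_or_ge m m₀ with h1 | h1
  · exact Or.inl ⟨m, h1, rfl⟩
  · obtain ⟨z, hz, hm⟩ := h m h1
    exact Or.inr ⟨z, hz, hm.symm⟩

theorem IsExpansion.exists_digits_le {x : ℕ → ℝ} {n : Stream' ℕ} (h : IsExpansion x n)
    (hfin : (Set.range x).Finite) : ∃ M, ∀ i, n.get i ≤ M := by
  obtain ⟨C, hC⟩ := (hfin.image fun y => 1 / y).bddAbove
  obtain ⟨M, hM⟩ := exists_nat_ge (C + 1)
  refine ⟨M, fun i => ?_⟩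
  have h1 : 1 / x i ≤ C := hC ⟨x i, ⟨i, rfl⟩, rfl⟩
  rw [h.step] at h1
  have h2 := h.lt_one (i + 1)
  have : (n.get i : ℝ) ≤ M := by linarith
  exact_mod_cast this

theorem finite_upSet {x : ℕ → ℝ} {n : Stream' ℕ} (h : IsExpansion x n)
    (hfin : (Set.range x).Finite) : (upSet x n).Finite := by
  obtain ⟨M, hM⟩ := h.exists_digits_le hfin
  have hF : (Set.range x ×ˢ Set.Iio M).Finite := hfin.prod (Set.finite_Iio M)
  refine ((hF.image fun p => 1 / ((p.2 : ℝ) - p.1)).union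
    ((hF.image fun p => 1 / ((p.2 : ℝ) - p.1) + 1).union
      (hF.image fun p => 1 / ((p.2 : ℝ) - p.1) - 1))).subset ?_
  rintro y ⟨i, k, -, hk, hy⟩
  have hmem : (x (i + 1), k) ∈ Set.range x ×ˢ Set.Iio M :=
    ⟨⟨i + 1, rfl⟩, hk.trans_le (hM i)⟩
  rcases hy with hy | hy | ⟨-, hy⟩
  · exact Or.inl ⟨_, hmem, hy.symm⟩
  · exact Or.inr (Or.inl ⟨_, hmem, hy.symm⟩)
  · exact Or.inr (Or.inr ⟨_, hmem, hy.symm⟩)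

theorem finite_loSet {x : ℕ → ℝ} {n : Stream' ℕ} (h : IsExpansion x n)
    (hfin : (Set.range x).Finite) : (loSet x n).Finite := by
  obtain ⟨M, hM⟩ := h.exists_digits_le hfin
  have hF : (Set.range x ×ˢ Set.Iic M).Finite := hfin.prod (Set.finite_Iic M)
  refine (hF.image fun p => p.1 - (p.2 : ℝ)).subset ?_
  rintro y ⟨i, k, hk, hy⟩
  exact ⟨(x (i + 1), k), ⟨⟨i + 1, rfl⟩, hk.trans (hM i)⟩, hy.symm⟩

theorem SplitPoint.tame_of_finite_range {s : SplitPoint} {x : ℕ → ℝ} {n : Stream' ℕ}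
    (h : IsExpansion x n) (ha : s.a < 0)
    (hb : 0 < s.b) (hab : s.a ≤ s.b - 1) (hxb : ∀ i, 1 / x i ≤ 1 / s.b + 1)
    (hxa : ∀ i, x (i + 1) ≤ s.a + 1) (hup : s.UpAt (x 0 / (1 - x 0))) (hlo : s.LoAt (-1 / x 0))
    (hfin : (Set.range x).Finite) : s.Tame := by
  obtain ⟨m₁, h1⟩ := hup
  obtain ⟨m₂, h2⟩ := hlo
  exact Or.inr ⟨finite_range_of_le (finite_loSet h hfin) fun m => lo_mem_of_le h ha hab hxa h2,
    finite_range_of_le (finite_upSet h hfin) fun m => up_mem_of_le h ha hb hab hxb h1⟩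

/-! ### The region `a ≤ -1` -/

theorem tame_splitA_of_le {a b : ℝ} (ha : a ≤ -1) (hb : 0 ≤ b) (hb1 : b ≤ 1)
    (hab : -(a * b) ≤ 1) : (splitA a b).Tame := by
  have ha0 : a ≠ 0 := by linarith
  have hba : b ≤ -1 / a := by rw [le_div_iff_of_neg (by linarith)]; linarith
  have hup : (splitA a b).UpAt (-1 / a) := ⟨0, S_coe ha0⟩
  have hup1 := hup.sub_one (show a ≤ _ by linarith) hba
  have hlo : (splitA a b).LoAt (a + 1) := ⟨0, rfl⟩
  left
  rcases ha.lt_or_eq with h | rfl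
  · have h1 : a + 1 < 0 := by linarith
    have hlo1 := hlo.S (show a < _ by linarith) (show _ ≤ b by linarith) h1.ne
    have h2 : -1 / a < 1 := by rw [div_lt_one_of_neg (by linarith)]; linarith
    have h3 : 0 ≤ -1 / a := hb.trans hba
    have hup2 := hup1.S (show a ≤ _ by linarith) (show _ < b by linarith) (by linarith)
    have h4 : -1 / (-1 / a - 1) = -1 / (a + 1) + 1 := by
      have h5 : a + 1 ≠ 0 := h1.ne
      have h6 : -1 / a - 1 = -(a + 1) / a := by field_simp; ring
      rw [h6]
      field_simp
      ring
    have h5 : 0 < -1 / (a + 1) := div_pos_of_neg_of_neg (by norm_num) h1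
    rw [h4] at hup2
    -- both orbits of `a` reach `S T a`
    have hup3 := hup2.sub_one (show a ≤ _ by linarith) (show b ≤ _ by linarith)
    rw [add_sub_cancel_right] at hup3
    exact hup3.hasCycle hlo1
  · norm_num at hup1 hlo
    exact hup1.hasCycle hlo

/-- For `b = 0` there is no cycle, but the lower orbit is constantly `∞`, and the upper one goes
around `-1`, `1`, `0`. -/
theorem tame_splitB_of_eq_zero {a : ℝ} (ha : a ≤ -1) : (splitB a 0).Tame := by
  right
  constructor
  · refine (Set.finite_singleton (OnePoint.infty : OnePoint ℝ)).subset ?_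
    rintro _ ⟨k, rfl⟩
    induction k with
    | zero => exact if_pos rfl
    | succ k ih =>
      rw [Set.mem_singleton_iff] at ih ⊢
      rw [SplitPoint.lo_succ, ih]
      rfl
  · refine ((Set.toFinite ({-1, 1, 0} : Set ℝ)).image ((↑) : ℝ → OnePoint ℝ)).subset ?_
    rintro _ ⟨k, rfl⟩
    induction k with
    | zero =>
      refine ⟨-1, by simp, ?_⟩
      change _ = T⁻¹ ((0 : ℝ) : OnePoint ℝ)
      rw [T_inv_coe, zero_sub]
    | succ k ih =>
      obtain ⟨y, hy, hk⟩ := ih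
      rw [SplitPoint.up_succ, ← hk]
      simp only [Set.mem_insert_iff, Set.mem_singleton_iff] at hy
      change rhoUpper a 0 (y : OnePoint ℝ) (y : OnePoint ℝ) ∈ _
      rw [rhoUpper_coe]
      rcases hy with rfl | rfl | rfl
      · rw [if_neg ha.not_gt, if_pos (by norm_num), S_coe (by norm_num)]
        exact ⟨1, by simp, by norm_num⟩
      · rw [if_neg (by linarith), if_neg (by norm_num), T_inv_coe]
        exact ⟨0, by simp, by norm_num⟩
      · rw [if_neg (by linarith), if_neg (by norm_num), T_inv_coe]
        exact ⟨-1, by simp, by norm_num⟩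

theorem upAt_splitB (a b : ℝ) : (splitB a b).UpAt (1 / (1 / b) - 1) :=
  ⟨0, by rw [one_div_one_div]; rfl⟩

theorem loAt_splitB {a b : ℝ} (hb : b ≠ 0) : (splitB a b).LoAt (-1 / b) :=
  ⟨0, S_coe hb⟩

theorem loAt_splitB' {a b : ℝ} (hb : 0 < b) (hab : -(a * b) ≤ 1) :
    (splitB a b).LoAt (1 - 1 / b) := by
  have h := (loAt_splitB (a := a) hb.ne').add_one
    (show -1 / b ≤ a by rw [div_le_iff₀ hb]; linarith)
  rwa [show -1 / b + 1 = 1 - 1 / b by ring] at h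

/-- Without a cycle, the descent would end at some `t` with `-a ≤ t < 1`, which is impossible. -/
theorem tame_splitB_of_le {a b : ℝ} (ha : a ≤ -1) (hb : 0 < b)
    (hab : -(a * b) ≤ 1) : (splitB a b).Tame := by
  by_contra h
  rw [SplitPoint.Tame, not_or] at h
  obtain ⟨k, h1, h2, -⟩ := SplitPoint.descent (s := splitB a b) hb
    (show a ≤ b - 1 by linarith) (show a < 0 by linarith) h.1 (t := 1 / b)
    (show -a ≤ 1 / b by rw [le_div_iff₀ hb]; linarith) le_rfl (upAt_splitB a b)
    (loAt_splitB' hb hab)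
  have h3 : -a ≤ 1 / b - k := h2
  linarith

/-! ### The region `-1 < a` -/

/-- `b` is the value of a continued fraction whose digits are generated by block substitutions. -/
def IsGenValue (b : ℝ) : Prop :=
  ∃ (x : ℕ → ℝ) (m : ℕ) (σ : Stream' ℕ), IsExpansion x (σ.map (· + m)) ∧ x 0 = b ∧ Gen σ

/-- If the orbits of `a` do not meet and are not both finite, then `b = a + 1`: for `b > a + 1`
there would be a gap between `1 / b + 1` and the supremum `1 / (a + 1) + 1` of the numbers `1 / x
i`. -/
theorem not_tame_splitA {a b : ℝ} (hb : 0 < b) (hab : a ≤ b - 1) (hba : b ≤ -a) (ha1 : -1 < a)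
    (h : ¬ (splitA a b).Tame) : b = a + 1 ∧ IsGenValue b := by
  have hcyc : ¬ (splitA a b).HasCycle := fun hc => h (Or.inl hc)
  have ha0 : a < 0 := by linarith
  have hlo : (splitA a b).LoAt (a + 1) := ⟨0, rfl⟩
  have hlt : 1 < -1 / a := by rw [one_lt_div_of_neg ha0]; linarith
  have hup := (show (splitA a b).UpAt (-1 / a) from ⟨0, S_coe ha0.ne⟩).sub_one
    (show a ≤ _ by linarith) (show b ≤ _ by linarith)
  rw [show -1 / a - 1 = (a + 1) / (1 - (a + 1)) by
    have := ha0.ne; rw [sub_add_cancel_right]; field_simp; ring] at hup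
  obtain ⟨x, n, h0, hmem, hxb, hstep⟩ := SplitPoint.Return.exists_seq (s := splitA a b) hb hab
    hba ha1 hcyc (x₀ := a + 1) ⟨by linarith, le_rfl, hlo, hup⟩
  have hmem' : ∀ i, x i ≤ a + 1 := fun i => (hmem i).2
  have hexp : IsExpansion x n := ⟨fun i => (hmem i).1, fun i => by linarith [hmem' i],
    fun i => by linarith [hmem' (i + 1)], hstep⟩
  have hinf : (Set.range x).Infinite := by
    intro hfin
    refine h (SplitPoint.tame_of_finite_range hexp ha0 hb hab hxb (fun i => hmem' (i + 1)) ?_ ?_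
      hfin)
    · rw [h0]; exact hup
    · rw [h0]; exact hlo.S (show a < _ by linarith) (show _ ≤ b by linarith) (by linarith)
  have hxb' : ∀ i, 1 / x i ≤ 1 / b + 1 := hxb
  have hab1 : 1 / b ≤ 1 / (a + 1) := one_div_le_one_div_of_le (by linarith) (by linarith)
  obtain ⟨σ, hσ, hn⟩ := hexp.exists_gen (fun i => by rw [h0]; exact hmem' i)
    (fun i => by rw [h0]; linarith [hxb' i]) hinf
  rw [hn] at hexp
  have hb' : b = a + 1 := by
    by_contra hne
    have h1 : a + 1 < b := lt_of_le_of_ne (by linarith) (Ne.symm hne)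
    have h2 : 1 / b < 1 / (a + 1) := one_div_lt_one_div_of_lt (by linarith) h1
    obtain ⟨k, hk⟩ := hexp.exists_lt_one_div hσ (δ := 1 / b + 1) (by rw [h0]; linarith)
    linarith [hxb' k]
  exact ⟨hb', x, _, σ, hexp, h0.trans hb'.symm, hσ⟩

/-- If the orbits of `b` do not meet and are not both finite, then `b = a + 1`: for `b > a + 1`
there would be a gap between `a + 1` and the supremum `b` of the numbers `x i`. -/
theorem not_tame_splitB {a b : ℝ} (hb : 0 < b) (hab : a ≤ b - 1) (hba : b ≤ -a) (ha1 : -1 < a)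
    (h : ¬ (splitB a b).Tame) : b = a + 1 ∧ IsGenValue b := by
  have hcyc : ¬ (splitB a b).HasCycle := fun hc => h (Or.inl hc)
  have ha0 : a < 0 := by linarith
  have hb1 : b < 1 := by linarith
  have hinv : 1 < 1 / b := one_lt_one_div hb hb1
  obtain ⟨k, y, hk, hy⟩ := SplitPoint.exists_return (s := splitB a b) hb hab ha0 hcyc
    (t := 1 / b) (show -a ≤ 1 / b by linarith) le_rfl (upAt_splitB a b)
    (loAt_splitB' hb (by nlinarith))
  obtain ⟨x, n, h0, hmem, hxb, hstep⟩ := SplitPoint.Return.exists_seq (s := splitB a b) hb hab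
    hba ha1 hcyc hy
  have hmem' : ∀ i, x i ≤ a + 1 := fun i => (hmem i).2
  have hxb' : ∀ i, 1 / x i ≤ 1 / b + 1 := hxb
  set x' : ℕ → ℝ := fun i => Nat.casesOn i b x with hx'
  have hexp : IsExpansion x' (Stream'.cons (k + 1) n) := by
    refine ⟨fun i => ?_, fun i => ?_, fun i => ?_, fun i => ?_⟩
    · cases i with
      | zero => exact hb
      | succ i => exact (hmem i).1
    · cases i with
      | zero => exact hb1
      | succ i => exact lt_of_le_of_lt (hmem' i) (by linarith)
    · exact (hmem' i).trans (by linarith)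
    · cases i with
      | zero =>
        change 1 / b = ((k + 1 : ℕ) : ℝ) - x 0
        rw [h0]; push_cast; exact hk
      | succ i => exact hstep i
  have hxb2 : ∀ i, 1 / x' i ≤ 1 / b + 1 := by
    intro i
    cases i with
    | zero => exact (lt_add_one _).le
    | succ i => exact hxb' i
  have hinf : (Set.range x').Infinite := by
    intro hfin
    refine h (SplitPoint.tame_of_finite_range hexp ha0 hb hab hxb2 hmem' ?_ (loAt_splitB hb.ne')
      hfin)
    -- the upper orbit of `b` starts with `b - 1`, `1 / (1 - b)`, `b / (1 - b)`
    have h1 := (upAt_splitB a b).S (show a ≤ _ by rw [one_div_one_div]; linarith)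
      (show _ < b by rw [one_div_one_div]; linarith) (by rw [one_div_one_div]; linarith)
    have h3 : 0 < 1 - b := by linarith
    have h2 : -1 / (1 / (1 / b) - 1) = b / (1 - b) + 1 := by
      have : b - 1 ≠ 0 := by linarith
      rw [one_div_one_div]
      field_simp
      ring
    have h4 : b ≤ b / (1 - b) := by rw [le_div_iff₀ h3]; nlinarith
    rw [h2] at h1
    have h5 := h1.sub_one (show a ≤ _ by linarith) (show b ≤ _ by linarith)
    rwa [add_sub_cancel_right] at h5
  obtain ⟨σ, hσ, hn⟩ := hexp.exists_gen (fun i => by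
    cases i with
    | zero => exact le_rfl
    | succ i => exact (hmem' i).trans (by change a + 1 ≤ b; linarith)) hxb2 hinf
  rw [hn] at hexp
  have hb' : b = a + 1 := by
    by_contra hne
    have h1 : a + 1 < b := lt_of_le_of_ne (by linarith) (Ne.symm hne)
    have h2 : 1 / b < 1 / (a + 1) := one_div_lt_one_div_of_lt (by linarith) h1
    obtain ⟨j, hj, hj'⟩ := hexp.exists_one_div_lt hσ (δ := 1 / (a + 1)) h2
    obtain ⟨i, rfl⟩ := Nat.exists_eq_add_of_le' hj
    exact absurd (one_div_le_one_div_of_le (hmem i).1 (hmem' i)) hj'.not_ge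
  exact ⟨hb', x', _, σ, hexp, rfl, hσ⟩

/-- In the half `b ≤ -a` of the parameter set, the finiteness condition fails only for `b = a + 1`
where `b` is the value of a generated continued fraction. -/
theorem of_not_finitenessCondition {a b : ℝ} (h : (a, b) ∈ paramSet) (hba : b ≤ -a)
    (hf : ¬ FinitenessCondition a b) : b = a + 1 ∧ IsGenValue b := by
  obtain ⟨h1, h2, h3, h4⟩ := h
  simp only at h1 h2 h3 h4
  have hA := not_tame_splitA (a := a) (b := b)
  have hB := not_tame_splitB (a := a) (b := b)
  rw [finitenessCondition_iff, not_and_or] at hf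
  rcases le_or_gt a (-1) with ha | ha
  · exfalso
    rcases hf with hf | hf
    · exact hf (tame_splitA_of_le ha h2 (by nlinarith) h4)
    · rcases h2.lt_or_eq with h5 | h5
      · exact hf (tame_splitB_of_le ha h5 h4)
      · subst h5
        exact hf (tame_splitB_of_eq_zero ha)
  · have hb : 0 < b := by linarith
    rcases hf with hf | hf
    · exact hA hb (by linarith) hba ha hf
    · exact hB hb (by linarith) hba ha hf

/-! ### Exceptional points -/

theorem IsExpansion.le_zero {x : ℕ → ℝ} {m : ℕ} {σ : Stream' ℕ}
    (h : IsExpansion x (σ.map (· + m))) (h0 : x 0 ≤ 1 / 2) (hσ : Adm σ) (i : ℕ) : x i ≤ x 0 := by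
  have hi : x i ≤ 1 / 2 := by
    cases i with
    | zero => exact h0
    | succ i => exact h.le_half i
  have hd := h.drop i
  rw [Stream'.drop_map] at hd
  have := le_of_forall_le_add_pow fun N => hd.le_add_of_lexLE h (by simpa using hi) h0
    (lexLE_map_add.2 (hσ.lower i N))
  simpa using this

theorem IsExpansion.one_div_le {x : ℕ → ℝ} {m : ℕ} {σ : Stream' ℕ}
    (h : IsExpansion x (σ.map (· + m))) (hσ : Adm σ) (i : ℕ) :
    1 / x i ≤ 1 / x 0 + 1 := by
  rw [h.step, h.step, Stream'.get_map, Stream'.get_map, hσ.get_zero]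
  have h1 := h.lt_one (0 + 1)
  have h2 := h.pos (i + 1)
  rcases (hσ.binary i).lt_or_eq with h3 | h3
  · rw [Nat.lt_one_iff.1 h3]
    linarith
  · have h4 : (σ.drop i).get 0 = 1 := by rw [Stream'.get_drop, Nat.add_zero]; exact h3
    have h5 := hσ.upper i
    rw [eq_cons_tail _ h4, top, Stream'.tail_drop'] at h5
    have hd := h.drop (i + 1)
    have ht := h.tail
    rw [Stream'.drop_map] at hd
    rw [Stream'.tail_map] at ht
    have h6 := le_of_forall_le_add_pow fun N => ht.le_add_of_lexLE hd (h.le_half 0)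
      (by simpa using h.le_half i) (lexLE_map_add.2 (lexLE_tail h5 N))
    rw [h3]
    simp only [Nat.zero_add] at h6 ⊢
    push_cast
    linarith

theorem IsExpansion.injective {x : ℕ → ℝ} {n : Stream' ℕ} (h : IsExpansion x n)
    (hn : ¬ EventuallyPeriodic n) : Function.Injective x := by
  have key : ∀ i p, 0 < p → x (i + p) ≠ x i := by
    intro i p hp heq
    refine hn ((eventuallyPeriodic_iff n).2 ⟨i, p, hp, ?_⟩)
    exact (h.drop (i + p)).digits_eq (h.drop i) (by simpa using heq)
  intro i j hij
  by_contra hne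
  rcases Nat.lt_or_gt_of_ne hne with h1 | h1
  · obtain ⟨p, rfl⟩ := Nat.exists_eq_add_of_lt h1
    exact key i (p + 1) (by omega) hij.symm
  · obtain ⟨p, rfl⟩ := Nat.exists_eq_add_of_lt h1
    exact key j (p + 1) (by omega) hij

theorem loAt_of_isExpansion {s : SplitPoint} {x : ℕ → ℝ} {n : Stream' ℕ} (h : IsExpansion x n)
    (ha : s.a < 0) (hab : s.a ≤ s.b - 1) (hxa : ∀ i, x (i + 1) ≤ s.a + 1)
    (hlo : s.LoAt (-1 / x 0)) (i : ℕ) : s.LoAt (x (i + 1)) := by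
  have down : ∀ (i k : ℕ), s.LoAt (x (i + 1) - k) → s.LoAt (x (i + 1)) := by
    intro i k hk
    induction k with
    | zero => simpa using hk
    | succ k ih =>
      have h1 := hxa i
      have h2 : (0 : ℝ) ≤ k := k.cast_nonneg
      have := hk.add_one (by push_cast; linarith)
      refine ih ?_
      rwa [show x (i + 1) - ((k + 1 : ℕ) : ℝ) + 1 = x (i + 1) - k by push_cast; ring] at this
  induction i with
  | zero =>
    refine down 0 (n.get 0) ?_
    rwa [neg_div, h.step, neg_sub] at hlo
  | succ i ih =>
    refine down (i + 1) (n.get (i + 1)) ?_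
    have h1 := hxa i
    have h2 := h.pos (i + 1)
    have h3 := ih.S (by linarith) (by linarith) h2.ne'
    rwa [neg_div, h.step, neg_sub] at h3

/-- The point `(b - 1, b)` is exceptional, for a generated expansion of `b`: the upper orbit of `b`
stays in `[a, 0) ∪ [b, ∞)` and the lower one in `(-∞, a) ∪ (0, b)`, where it visits all the `x i`.
-/
theorem not_tame_of_gen {x : ℕ → ℝ} {m : ℕ} {σ : Stream' ℕ} (h : IsExpansion x (σ.map (· + m)))
    (h0 : x 0 ≤ 1 / 2) (hσ : Gen σ) : ¬ (splitB (x 0 - 1) (x 0)).Tame := by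
  set b := x 0 with hb
  have hb0 : 0 < b := h.pos 0
  have hle := h.le_zero h0 hσ.adm
  have hxb := h.one_div_le hσ.adm
  have hinj : Function.Injective x :=
    h.injective fun hp => hσ.not_eventuallyPeriodic (eventuallyPeriodic_map_add.1 hp)
  have hlt : ∀ i, x (i + 1) < b := fun i =>
    lt_of_le_of_ne (hle _) fun heq => absurd (hinj heq) (Nat.succ_ne_zero i)
  have hlt' : ∀ i, x (i + 1) ≤ b - 1 + 1 := fun i => by linarith [hlt i]
  set s := splitB (b - 1) b with hs
  have hup0 : s.up 0 = ((b - 1 : ℝ) : OnePoint ℝ) := rfl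
  have hup1 : s.up 1 = ((1 / (1 - b) : ℝ) : OnePoint ℝ) := by
    rw [SplitPoint.up_succ, hup0, rhoUpper_coe]
    change (if b - 1 < b - 1 then T else if b - 1 < b then S else T⁻¹) _ = _
    rw [if_neg (lt_irrefl _), if_pos (by linarith), S_coe (by linarith), ← neg_sub 1 b,
      neg_div_neg_eq]
  have hbig : b < 1 / (1 - b) := by rw [lt_div_iff₀ (by linarith)]; nlinarith
  have hup2 : s.up 2 = ((b / (1 - b) : ℝ) : OnePoint ℝ) := by
    rw [SplitPoint.up_succ, hup1, rhoUpper_coe]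
    change (if _ < b - 1 then T else if _ < b then S else T⁻¹) _ = _
    rw [if_neg (by linarith), if_neg hbig.not_gt, T_inv_coe]
    congr 1
    have : 1 - b ≠ 0 := by linarith
    field_simp
    ring
  rintro (⟨j, k, hjk⟩ | ⟨hfin, -⟩)
  · obtain ⟨y, ⟨i, q, -, rfl⟩, hy⟩ := SplitPoint.lo_mem_of_le (s := s) h
      (show b - 1 < 0 by linarith) le_rfl hlt' (m₀ := 0) (S_coe hb0.ne') (Nat.zero_le k)
    have hlow : x (i + 1) - q < b - 1 ∨ 0 < x (i + 1) - q ∧ x (i + 1) - q < b := by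
      rcases Nat.eq_zero_or_pos q with rfl | hq
      · right
        simpa using ⟨h.pos (i + 1), hlt i⟩
      · left
        have : (1 : ℝ) ≤ q := by exact_mod_cast hq
        linarith [hlt i]
    have hupp : ∃ z : ℝ, s.up j = (z : OnePoint ℝ) ∧ (b - 1 ≤ z ∧ z < 0 ∨ b ≤ z) := by
      obtain rfl | rfl | hj : j = 0 ∨ j = 1 ∨ 2 ≤ j := by omega
      · exact ⟨_, hup0, Or.inl ⟨le_rfl, by linarith⟩⟩
      · exact ⟨_, hup1, Or.inr hbig.le⟩
      · obtain ⟨z, ⟨i, k, h1, hk, hz⟩, hzj⟩ := SplitPoint.up_mem_of_le (s := s) h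
          (show b - 1 < 0 by linarith) hb0 le_rfl hxb hup2 hj
        refine ⟨z, hzj, ?_⟩
        obtain ⟨h2, h3, h4⟩ := h.bounds_of_lt hb0 hxb h1 hk
        rcases hz with rfl | rfl | ⟨h5, rfl⟩
        · exact Or.inr h3
        · right; linarith
        · left
          have := h4 h5
          constructor <;> linarith
    obtain ⟨z, hz, hz'⟩ := hupp
    rw [hz, hy] at hjk
    have hzy : z = x (i + 1) - q := OnePoint.coe_injective hjk
    rw [← hzy] at hlow
    rcases hz' with h1 | h1 <;> rcases hlow with h2 | h2 <;> linarith
  · have hlo : s.LoAt (-1 / x 0) := ⟨0, S_coe hb0.ne'⟩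
    have hall := loAt_of_isExpansion (s := s) h (show b - 1 < 0 by linarith) le_rfl hlt' hlo
    refine (Set.infinite_range_of_injective (f := fun i => ((x (i + 1) : ℝ) : OnePoint ℝ))
      fun i j hij => ?_) (hfin.subset ?_)
    · exact Nat.succ_injective (hinj (OnePoint.coe_injective hij))
    · rintro _ ⟨i, rfl⟩
      exact hall i

theorem mem_exceptionalSet_of_gen {x : ℕ → ℝ} {m : ℕ} {σ : Stream' ℕ}
    (h : IsExpansion x (σ.map (· + m))) (h0 : x 0 ≤ 1 / 2) (hσ : Gen σ) :
    (x 0 - 1, x 0) ∈ exceptionalSet := by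
  have h1 := h.pos 0
  refine ⟨⟨?_, h1.le, ?_, ?_⟩, fun hf => ?_⟩
  · simp only; linarith
  · simp only; linarith
  · simp only; nlinarith
  · exact not_tame_of_gen h h0 hσ ((finitenessCondition_iff _ _).1 hf).2

/-- Generated sequences of digits have a value, and it is an exceptional parameter. -/
theorem IsGenerated.exists_isExpansion {m : ℕ} (hm : 3 ≤ m) {r : ℕ → Rule} {σ : Stream' ℕ}
    (h : IsGenerated m r σ) : ∃ (τ : Stream' ℕ) (x : ℕ → ℝ), IsGenerated 0 r τ ∧ σ = τ.map (· + m) ∧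
      IsExpansion x (τ.map (· + m)) ∧ x 0 ≤ 1 / 2 ∧ IsMinusFracValue σ (x 0) := by
  obtain ⟨τ, hτ⟩ := exists_isGenerated 0 r
  have hσ : σ = τ.map (· + m) := h.unique ((isGenerated_add_iff m r τ).2 hτ)
  obtain ⟨x, hx, hx0, hv⟩ := ABCF.exists_isExpansion (n := τ.map (· + m)) fun i => by
    rw [Stream'.get_map]; omega
  exact ⟨τ, x, hτ, hσ, hx, hx0, hσ ▸ hv⟩

theorem mem_blockPoints_of_isGenValue {b : ℝ} (hb : b ≤ 1 / 2) (h : IsGenValue b) :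
    (b - 1, b) ∈ blockPoints := by
  obtain ⟨x, m, σ, hx, rfl, r, hr⟩ := h
  have hm := hx.three_le hb 0
  rw [Stream'.get_map, Gen.get_zero ⟨r, hr⟩, Nat.zero_add] at hm
  exact ⟨m, hm, r, σ.map (· + m), x 0, (isGenerated_add_iff m r σ).2 hr,
    hx.isMinusFracValue hb, rfl⟩

theorem eq_blockPoints :
    {p : ℝ × ℝ | p ∈ exceptionalSet ∧ p.2 ≤ -p.1} = blockPoints := by
  ext ⟨a, b⟩
  constructor
  · rintro ⟨⟨h, hf⟩, hba⟩
    simp only at hba hf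
    obtain ⟨hb, hg⟩ := of_not_finitenessCondition h hba hf
    have := mem_blockPoints_of_isGenValue (by linarith) hg
    rwa [show b - 1 = a by linarith] at this
  · rintro ⟨m, hm, r, σ, b', hσ, hv, hp⟩
    obtain ⟨τ, x, hτ, -, hx, hx0, hv'⟩ := IsGenerated.exists_isExpansion (σ := σ) hm hσ
    have hb' : b' = x 0 := tendsto_nhds_unique hv hv'
    subst hb'
    rw [hp]
    refine ⟨mem_exceptionalSet_of_gen hx hx0 ⟨r, hτ⟩, ?_⟩
    simp only
    linarith

/-- On the whole parameter set, the finiteness condition can fail only for `b = a + 1`. -/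
theorem finitenessCondition_of_ne {a b : ℝ} (h : (a, b) ∈ paramSet) (hb : b ≠ a + 1) :
    FinitenessCondition a b := by
  rcases le_total b (-a) with h1 | h1
  · by_contra hf
    exact hb (of_not_finitenessCondition h h1 hf).1
  · rw [← finitenessCondition_reflect_iff (h.1.trans h.2.1)]
    by_contra hf
    have := (of_not_finitenessCondition (reflect_mem_paramSet h) (by linarith) hf).1
    exact hb (by linarith)

/-! ### Size of the exceptional set -/

/-- The values in `(0, 1/2]` of the continued fractions with digits `m` and `m + 1`. -/
def twoDigitValues (m : ℕ) : Set ℝ :=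
  {b | ∃ (x : ℕ → ℝ) (n : Stream' ℕ), IsExpansion x n ∧ x 0 = b ∧ b ≤ 1 / 2 ∧
    ∀ i, n.get i = m ∨ n.get i = m + 1}

theorem twoDigitValues_subset (m : ℕ) : twoDigitValues m ⊆
    (fun t => 1 / ((m : ℝ) - t)) '' twoDigitValues m ∪
      (fun t => 1 / (((m + 1 : ℕ) : ℝ) - t)) '' twoDigitValues m := by
  rintro b ⟨x, n, hx, rfl, -, hn⟩
  have h1 : x 1 ∈ twoDigitValues m :=
    ⟨_, _, hx.tail, rfl, hx.le_half 0, fun i => hn (i + 1)⟩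
  have h2 : x 0 = 1 / (n.get 0 - x 1) := by rw [← hx.step 0, one_div_one_div]
  rcases hn 0 with h | h
  · exact Or.inl ⟨x 1, h1, by rw [h2, h]⟩
  · exact Or.inr ⟨x 1, h1, by rw [h2, h]⟩

theorem volume_image_le {m : ℕ} (hm : 3 ≤ m) {K : Set ℝ} (hK : ∀ t ∈ K, t ≤ 1 / 2) :
    volume ((fun t => 1 / ((m : ℝ) - t)) '' K) ≤ (1 / 4 : ENNReal) * volume K := by
  have hm' : (3 : ℝ) ≤ m := by exact_mod_cast hm
  have hL : LipschitzOnWith (1 / 4) (fun t : ℝ => 1 / ((m : ℝ) - t)) K := by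
    refine LipschitzOnWith.of_dist_le_mul fun s hs t ht => ?_
    rw [Real.dist_eq, Real.dist_eq]
    have := abs_one_div_sub_le hm' (hK s hs) (hK t ht) le_rfl
    push_cast
    linarith
  have := hL.hausdorffMeasure_image_le (d := 1) zero_le_one
  rw [hausdorffMeasure_real, ENNReal.rpow_one] at this
  refine this.trans (le_of_eq ?_)
  congr 1
  simp

/-- The two branches contract lengths by the factor `1/4`. -/
theorem volume_twoDigitValues {m : ℕ} (hm : 3 ≤ m) : volume (twoDigitValues m) = 0 := by
  have hK : ∀ t ∈ twoDigitValues m, t ≤ 1 / 2 := fun t ⟨_, _, _, _, h, _⟩ => h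
  have hfin : volume (twoDigitValues m) ≠ ⊤ := by
    refine ((measure_mono (t := Set.Icc (0 : ℝ) (1 / 2)) ?_).trans_lt measure_Icc_lt_top).ne
    rintro t ⟨x, n, hx, rfl, h, -⟩
    exact ⟨(hx.pos 0).le, h⟩
  have h1 : volume (twoDigitValues m) ≤
      1 / 4 * volume (twoDigitValues m) + 1 / 4 * volume (twoDigitValues m) :=
    (measure_mono (twoDigitValues_subset m)).trans ((measure_union_le _ _).trans
      (add_le_add (volume_image_le hm hK) (volume_image_le (by omega) hK)))
  obtain ⟨v, hv⟩ : ∃ v : NNReal, volume (twoDigitValues m) = v :=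
    ⟨_, (ENNReal.coe_toNNReal hfin).symm⟩
  rw [hv] at h1 ⊢
  have h2 : (v : ENNReal) ≤ ((1 / 4 * v + 1 / 4 * v : NNReal) : ENNReal) := by
    refine h1.trans (le_of_eq ?_)
    push_cast
    simp
  have h3 : v ≤ 1 / 4 * v + 1 / 4 * v := by exact_mod_cast h2
  have h4 : (v : ℝ) ≤ 1 / 4 * v + 1 / 4 * v := by exact_mod_cast h3
  have h5 : (0 : ℝ) ≤ v := v.2
  have h6 : (v : ℝ) = 0 := by linarith
  have h7 : v = 0 := by exact_mod_cast h6
  rw [h7]; rfl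

theorem mem_twoDigitValues_of_mem_blockPoints {b : ℝ} (h : (b - 1, b) ∈ blockPoints) :
    ∃ m, 3 ≤ m ∧ b ∈ twoDigitValues m := by
  obtain ⟨m, hm, r, σ, b', hσ, hv, hp⟩ := h
  obtain ⟨τ, x, hτ, -, hx, hx0, hv'⟩ := IsGenerated.exists_isExpansion (σ := σ) hm hσ
  have hb' : b' = x 0 := tendsto_nhds_unique hv hv'
  have hb : b = x 0 := (congrArg Prod.snd hp).trans hb'
  refine ⟨m, hm, x, _, hx, hb.symm, by rw [hb]; exact hx0, fun i => ?_⟩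
  have := Gen.binary ⟨r, hτ⟩ i
  rw [Stream'.get_map]
  omega

theorem volume_exceptionalSet : volume {b : ℝ | (b - 1, b) ∈ exceptionalSet} = 0 := by
  set K : Set ℝ := ⋃ m ∈ Set.Ici 3, twoDigitValues m with hK
  have hK0 : volume K = 0 :=
    (measure_biUnion_null_iff (Set.to_countable _)).2 fun m hm => volume_twoDigitValues hm
  have hK1 : volume ((fun t : ℝ => 1 - t) ⁻¹' K) = 0 :=
    (Measure.measurePreserving_sub_left volume (1 : ℝ)).quasiMeasurePreserving.preimage_null hK0
  refine measure_mono_null ?_ (measure_union_null hK0 hK1)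
  have key : ∀ b : ℝ, (b - 1, b) ∈ exceptionalSet → b ≤ 1 / 2 → b ∈ K := by
    intro b hb hb'
    have h1 : (b - 1, b) ∈ blockPoints := by
      rw [← eq_blockPoints]
      exact ⟨hb, by simp only; linarith⟩
    obtain ⟨m, hm, h2⟩ := mem_twoDigitValues_of_mem_blockPoints h1
    exact Set.mem_biUnion hm h2
  intro b hb
  rcases le_total b (1 / 2) with h1 | h1
  · exact Or.inl (key b hb h1)
  · right
    refine key (1 - b) ?_ (by linarith)
    have := reflect_mem_exceptionalSet hb
    rwa [show -(b - 1) = 1 - b by ring, show -b = 1 - b - 1 by ring] at this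

/-- A choice of block substitutions for every sequence of bits. Different sequences of bits lead to
different sequences of digits, which makes the exceptional set uncountable. -/
def bitRule (β : ℕ → Bool) (n : ℕ) : Rule :=
  if β n then Rule.caseA 2 le_rfl else Rule.caseA 3 (by norm_num)

theorem bit_zero_eq_of_isGenerated {β γ : ℕ → Bool} {σ : Stream' ℕ}
    (hβ : IsGenerated 0 (bitRule β) σ) (hγ : IsGenerated 0 (bitRule γ) σ) : β 0 = γ 0 := by
  have h2 : ∀ x : Stream' ℕ, x.get 0 = 0 → (subst (Rule.caseA 2 le_rfl) x).get 2 = 1 := by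
    intro x hx
    rw [subst_eq, hx, Rule.block_caseA_zero]; rfl
  have h3 : ∀ x : Stream' ℕ, x.get 0 = 0 →
      (subst (Rule.caseA 3 (by norm_num)) x).get 2 = 0 := by
    intro x hx
    rw [subst_eq, hx, Rule.block_caseA_zero]; rfl
  obtain ⟨x, hx, hβx⟩ := hβ.exists_eq_subst
  obtain ⟨y, hy, hγy⟩ := hγ.exists_eq_subst
  have hx0 := Gen.get_zero ⟨_, hx⟩
  have hy0 := Gen.get_zero ⟨_, hy⟩
  rw [hβx] at hγy
  have := congrArg (fun s => Stream'.get s 2) hγy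
  cases h4 : β 0 <;> cases h5 : γ 0 <;>
    simp [bitRule, h4, h5, h2 x hx0, h3 x hx0, h2 y hy0, h3 y hy0] at this ⊢

theorem bit_eq_of_isGenerated {β γ : ℕ → Bool} {σ : Stream' ℕ}
    (hβ : IsGenerated 0 (bitRule β) σ) (hγ : IsGenerated 0 (bitRule γ) σ) (n : ℕ) : β n = γ n := by
  induction n generalizing β γ σ with
  | zero => exact bit_zero_eq_of_isGenerated hβ hγ
  | succ n ih =>
    obtain ⟨x, hx, hβx⟩ := hβ.exists_eq_subst
    obtain ⟨y, hy, hγy⟩ := hγ.exists_eq_subst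
    have h0 : bitRule γ 0 = bitRule β 0 := by
      rw [bitRule, bitRule, bit_zero_eq_of_isGenerated hβ hγ]
    rw [h0] at hγy
    have hxy : x = y := subst_injective (Gen.binary ⟨_, hx⟩) (Gen.binary ⟨_, hy⟩) _
      (hβx.symm.trans hγy)
    subst hxy
    exact ih (β := fun i => β (i + 1)) (γ := fun i => γ (i + 1)) hx hy

theorem not_countable_exceptionalSet : ¬ exceptionalSet.Countable := by
  intro hc
  have hex : ∀ β : ℕ → Bool, ∃ (σ : Stream' ℕ) (x : ℕ → ℝ), IsGenerated 0 (bitRule β) σ ∧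
      IsExpansion x (σ.map (· + 3)) ∧ x 0 ≤ 1 / 2 := by
    intro β
    obtain ⟨τ, hτ⟩ := exists_isGenerated 3 (bitRule β)
    obtain ⟨σ, x, hσ, -, hx, hx0, -⟩ := IsGenerated.exists_isExpansion le_rfl hτ
    exact ⟨σ, x, hσ, hx, hx0⟩
  choose σ x hσ hx hx0 using hex
  have hmem : ∀ β, (x β 0 - 1, x β 0) ∈ exceptionalSet := fun β =>
    mem_exceptionalSet_of_gen (hx β) (hx0 β) ⟨_, hσ β⟩
  have : Countable exceptionalSet := hc.to_subtype
  have hinj : Function.Injective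
      (fun β => (⟨(x β 0 - 1, x β 0), hmem β⟩ : exceptionalSet)) := by
    intro β γ hβγ
    have h1 : x β 0 = x γ 0 := congrArg (fun p => p.1.2) hβγ
    have h2 := (hx β).digits_eq (hx γ) h1
    have h3 : σ β = σ γ := LexLE.antisymm
      (fun N => lexLE_map_add.1 (by rw [h2]; exact LexLE.refl N _))
      (fun N => lexLE_map_add.1 (by rw [h2]; exact LexLE.refl N _))
    exact funext fun n => bit_eq_of_isGenerated (hσ β) (h3 ▸ hσ γ) n
  have : Countable (ℕ → Bool) := hinj.countable
  obtain ⟨g, hg⟩ := exists_surjective_nat (ℕ → Bool)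
  obtain ⟨n, hn⟩ := hg fun n => !(g n n)
  simpa using congrFun hn n

end ABCF

theorem mainTheorem6 :
    -- off the diagonal boundary the finiteness condition holds
    (∀ a b : ℝ, (a, b) ∈ ABCF.paramSet → b ≠ a + 1 → ABCF.FinitenessCondition a b) ∧
    -- the exceptional set lies on the segment `b = a + 1` of the boundary of the parameter set
    ABCF.exceptionalSet ⊆ {p : ℝ × ℝ | p ∈ ABCF.paramSet ∧ p.2 = p.1 + 1} ∧
    -- it is uncountable
    ¬ ABCF.exceptionalSet.Countable ∧
    -- it has one-dimensional Lebesgue measure zero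
    MeasureTheory.volume {b : ℝ | (b - 1, b) ∈ ABCF.exceptionalSet} = 0 ∧
    -- its part with `b ≤ -a` is described by the block substitutions,
    {p : ℝ × ℝ | p ∈ ABCF.exceptionalSet ∧ p.2 ≤ -p.1} = ABCF.blockPoints ∧
    -- and the rest of it is the mirror image under `(a, b) ↦ (-b, -a)`
    (∀ a b : ℝ, (a, b) ∈ ABCF.exceptionalSet ↔ (-b, -a) ∈ ABCF.exceptionalSet) ∧
    -- every recursive choice of substitutions does produce a sequence, which is not eventually
    -- periodic, and an exceptional point
    (∀ m : ℕ, 3 ≤ m → ∀ r : ℕ → ABCF.Rule,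
      ∃ σ : ℕ → ℕ, ABCF.IsGenerated m r σ ∧ ¬ ABCF.EventuallyPeriodic σ ∧
        ∃ b : ℝ, ABCF.IsMinusFracValue σ b ∧ (b - 1, b) ∈ ABCF.exceptionalSet) := by
  refine ⟨fun a b => ABCF.finitenessCondition_of_ne, ?_, ABCF.not_countable_exceptionalSet,
    ABCF.volume_exceptionalSet, ABCF.eq_blockPoints, ABCF.reflect_mem_exceptionalSet_iff, ?_⟩
  · rintro ⟨a, b⟩ ⟨h, hf⟩
    refine ⟨h, ?_⟩
    by_contra hb
    exact hf (ABCF.finitenessCondition_of_ne h hb)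
  · intro m hm r
    obtain ⟨σ, hσ⟩ := ABCF.exists_isGenerated m r
    obtain ⟨τ, x, hτ, hστ, hx, hx0, hv⟩ := ABCF.IsGenerated.exists_isExpansion hm hσ
    refine ⟨σ, hσ, ?_, x 0, hv, ABCF.mem_exceptionalSet_of_gen hx hx0 ⟨r, hτ⟩⟩
    rw [hστ]
    exact fun hp => ABCF.Gen.not_eventuallyPeriodic ⟨r, hτ⟩
      (ABCF.eventuallyPeriodic_map_add.1 hp)
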